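/- Let $\lambda$ be the countable power of the uniform measure on $\{0,1\}$, a probability measure on $2^{\mathbb N}$, and let $L^0(\lambda,\mathbb T)$ be the group of $\lambda$-measurable functions $2^{\mathbb N}\to\mathbb T=\{z\in\mathbb C:|z|=1\}$ modulo equality $\lambda$-almost everywhere, with pointwise multiplication and the topology of convergence in measure. Let $\Sigma$ be the set of finite binary sequences, $$X_\infty=\Big\{f\in\mathbb C^{\Sigma}:\ f(s)=\tfrac{f(s0)+f(s1)}{\sqrt2}\ \text{ for all } s\in\Sigma\Big\},$$ and let $\gamma_\infty$ be the unique measure on $X_\infty$ whose image under $f\mapsto f\restriction 2^k$ is, for each $k\ge 0$, the product on $\mathbb C^{2^k}$ of copies of the Gaussian measure with density $\frac1\pi e^{-x^2-y^2}$. Let $\mathrm{Aut}(\gamma_\infty)$ be the group of invertible measure preserving transformations of $(X_\infty,\gamma_\infty)$ modulo equality almost everywhere, with the weak topology. For $n\ge0$, a step function $g\in L^0(\lambda,\mathbb T)$ of level $n$ (one that is constant, with value denoted $g_s$, on each cylinder $[s]$, $s\in 2^{m}$, $m\ge n$) acts on $X_\infty$ by $$(g\cdot f)(s)=\begin{cases}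 g_s f(s) & \text{if } |s|\ge n,\\ 2^{-k/2}\sum_{t\in 2^k} g_{st}f(st) & \text{if } |s|=n-k<n.\end{cases}$$ **Theorem.** The action of step functions extends uniquely to a continuous homomorphism $\Theta:L^0(\lambda,\mathbb T)\to\mathrm{Aut}(\gamma_\infty)$. The Koopman representation $g\mapsto\big(f\mapsto f\circ\Theta(g)^{-1}\big)$ of $L^0(\lambda,\mathbb T)$ on $L^2(\gamma_\infty)$, restricted to the orthogonal complement of the constant functions, is unitarily isomorphic to the $\ell^2$-sum, over all integers $p,q\ge0$ with $p+q>0$, of the representations $\rho_{p,q}$. Here $\rho_{p,q}$ acts on the closed subspace of $L^2\big((2^{\mathbb N})^p\times(2^{\mathbb N})^q,\lambda^{p+q}\big)$ of functions invariant under all permutations of the first $p$ coordinates and all permutations of the last $q$ coordinates, by $$\big(\rho_{p,q}(g)f\big)(a,b)=g(a_1)\cdots g(a_p)\,g(b_1)^{-1}\cdots g(b_q)^{-1}\,f(a,b).$$ -/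

import Mathlib

open MeasureTheory ProbabilityTheory
open scoped symmDiff ENNReal

noncomputable section

namespace KoopmanL0

/-! ### The group of measurable circle-valued functions on the Cantor space -/

/-- The space of infinite binary sequences (`false` is the digit 0 and `true` is the digit 1). -/
abbrev Cantor : Type := ℕ → Bool

/-- The countable power of the uniform measure on the two-point set. -/
def lam : Measure Cantor :=
  Measure.infinitePi fun _ : ℕ => (PMF.uniformOfFintype Bool).toMeasure

instance : IsProbabilityMeasure lam := by
  unfold lam; infer_instance

/-- Measurable functions from the Cantor space to the unit circle, modulo equality almost
everywhere. It is a commutative group under pointwise multiplication. -/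
abbrev L0 : Type := Cantor →ₘ[lam] Circle

/-- The topology of convergence in measure. -/
instance : TopologicalSpace L0 where
  IsOpen U := ∀ g ∈ U, ∃ ε : ℝ, 0 < ε ∧
    ∀ h : L0, lam {a | ε ≤ dist (h a) (g a)} < ENNReal.ofReal ε → h ∈ U
  isOpen_univ := fun _ _ => ⟨1, one_pos, fun _ _ => trivial⟩
  isOpen_inter := by
    rintro U V hU hV g ⟨hgU, hgV⟩
    obtain ⟨ε, hε, h1⟩ := hU g hgU
    obtain ⟨δ, hδ, h2⟩ := hV g hgV
    refine ⟨min ε δ, lt_min hε hδ, fun h hh => ⟨h1 h ?_, h2 h ?_⟩⟩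
    · refine lt_of_le_of_lt (measure_mono fun a ha => ?_)
        (hh.trans_le (ENNReal.ofReal_le_ofReal (min_le_left _ _)))
      exact le_trans (min_le_left ε δ) (by simpa using ha)
    · refine lt_of_le_of_lt (measure_mono fun a ha => ?_)
        (hh.trans_le (ENNReal.ofReal_le_ofReal (min_le_right _ _)))
      exact le_trans (min_le_right ε δ) (by simpa using ha)
  isOpen_sUnion := by
    intro s hs g hg
    obtain ⟨U, hU, hgU⟩ := hg
    obtain ⟨ε, hε, h1⟩ := hs U hU g hgU
    exact ⟨ε, hε, fun h hh => ⟨U, hU, h1 h hh⟩⟩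

/-- The element of `L0` that is constant with value `c s` on each cylinder `[s]`, where `s` is a
binary sequence of length `n`. For fixed `n` these elements form the subgroup of step functions
of level `n`. -/
def step {n : ℕ} (c : (Fin n → Bool) → Circle) : L0 :=
  AEEqFun.mk (fun a : Cantor => c fun i => a i)
    ((continuous_of_discreteTopology (f := c)).comp (by fun_prop)).aestronglyMeasurable

/-! ### The Gaussian space -/

/-- The law of a complex number whose real and imaginary parts are independent Gaussian variables
of mean 0 and variance 1/2. -/
def gam : Measure ℂ :=
  ((gaussianReal 0 (1 / 2)).prod (gaussianReal 0 (1 / 2))).map Complex.equivRealProdCLM.symm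

instance : IsGaussian gam := by
  unfold gam; infer_instance

/-- Functions `f` on the finite binary sequences with `f s = (f (s0) + f (s1)) / √2`. -/
def XInf : Type :=
  {f : List Bool → ℂ // ∀ s, f s = (f (s ++ [false]) + f (s ++ [true])) / (Real.sqrt 2 : ℂ)}

instance : CoeFun XInf fun _ => List Bool → ℂ := ⟨Subtype.val⟩

instance : TopologicalSpace XInf := instTopologicalSpaceSubtype

instance : MeasurableSpace XInf := Subtype.instMeasurableSpace

instance : BorelSpace XInf := Subtype.borelSpace _

instance : SecondCountableTopology XInf :=
  Topology.IsEmbedding.subtypeVal.secondCountableTopology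

instance : TopologicalSpace.MetrizableSpace XInf :=
  Topology.IsEmbedding.subtypeVal.metrizableSpace

/-- Restriction of an element of `XInf` to the binary sequences of length `k`. -/
def restrictLevel (k : ℕ) (f : XInf) : (Fin k → Bool) → ℂ := fun t => f (List.ofFn t)

lemma measurable_restrictLevel (k : ℕ) : Measurable (restrictLevel k) :=
  measurable_pi_lambda _ fun t => (measurable_pi_apply (List.ofFn t)).comp measurable_subtype_coe

/-- Value at `s` of the branching function with root value `ω none` and increments `ω (some s)`. -/
def branch (ω : Option (List Bool) → ℂ) (s : List Bool) : ℂ :=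
  (ω none + ∑ i ∈ Finset.range s.length, (Real.sqrt 2 : ℂ) ^ i *
    ((if s.getD i false then 1 else -1) * ω (some (s.take i)))) / (Real.sqrt 2 : ℂ) ^ s.length

lemma sqrt_two_ne : (Real.sqrt 2 : ℂ) ≠ 0 := by simp

lemma sqrt_two_mul : (Real.sqrt 2 : ℂ) * (Real.sqrt 2 : ℂ) = 2 := by
  rw [← Complex.ofReal_mul, Real.mul_self_sqrt (by norm_num)]; simp

lemma branch_append (ω : Option (List Bool) → ℂ) (s : List Bool) (b : Bool) :
    branch ω (s ++ [b]) =
      (branch ω s + (if b then 1 else -1) * ω (some s)) / (Real.sqrt 2 : ℂ) := by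
  have hs := sqrt_two_ne
  have h : ∀ i ∈ Finset.range s.length, (Real.sqrt 2 : ℂ) ^ i *
      ((if (s ++ [b]).getD i false then 1 else -1) * ω (some ((s ++ [b]).take i))) =
      (Real.sqrt 2 : ℂ) ^ i * ((if s.getD i false then 1 else -1) * ω (some (s.take i))) := by
    intro i hi
    have hi : i < s.length := by simpa using hi
    rw [List.take_append_of_le_length hi.le, List.getD_append _ _ _ _ hi]
  unfold branch
  rw [List.length_append, List.length_singleton, Finset.sum_range_succ, Finset.sum_congr rfl h]
  simp only [List.take_left, List.getD_append_right _ _ _ _ le_rfl, Nat.sub_self,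
    List.getD_cons_zero]
  field_simp
  ring

/-- The branching function as an element of `XInf`. -/
def branchX (ω : Option (List Bool) → ℂ) : XInf :=
  ⟨branch ω, fun s => by
    have hs := sqrt_two_ne
    have h2 := sqrt_two_mul
    rw [branch_append, branch_append]
    simp only [Bool.false_eq_true, if_false, if_true]
    field_simp
    rw [pow_two, h2]
    ring⟩

lemma measurable_branch (s : List Bool) : Measurable fun ω => branch ω s := by
  unfold branch
  fun_prop

lemma measurable_branchX : Measurable branchX :=
  Measurable.subtype_mk (measurable_pi_lambda _ measurable_branch)

/-- The measure on `XInf` whose image under restriction to the sequences of length `k` is the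
product of copies of `gam`, for each `k`; see `map_restrictLevel_gamInf` and
`eq_gamInf_of_map_restrictLevel` for this characterization. It is built as the law of the branching
function with independent increments of law `gam`. -/
def gamInf : Measure XInf :=
  (Measure.infinitePi fun _ : Option (List Bool) => gam).map branchX

instance : IsProbabilityMeasure gamInf :=
  Measure.isProbabilityMeasure_map measurable_branchX.aemeasurable

lemma map_rotation_gam :
    (gam.prod gam).map (fun x : ℂ × ℂ =>
      ((x.1 - x.2) / (Real.sqrt 2 : ℂ), (x.1 + x.2) / (Real.sqrt 2 : ℂ))) = gam.prod gam := by
  have h0 : ∫ z, id z ∂gam = 0 := by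
    have h1 : Integrable (fun x : ℝ × ℝ => x)
        ((gaussianReal 0 (1 / 2)).prod (gaussianReal 0 (1 / 2))) :=
      IsGaussian.integrable_id
    have h2 : ∫ x : ℝ × ℝ, x ∂((gaussianReal 0 (1 / 2)).prod (gaussianReal 0 (1 / 2))) = 0 := by
      ext
      · rw [fst_integral h1, integral_fun_fst (f := fun x : ℝ => x)]
        simp [integral_id_gaussianReal]
      · rw [snd_integral h1, integral_fun_snd (f := fun x : ℝ => x)]
        simp [integral_id_gaussianReal]
    unfold gam
    rw [integral_map (by fun_prop) (by fun_prop)]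
    simp only [id]
    rw [ContinuousLinearEquiv.integral_comp_comm, h2, map_zero]
  have h := IsGaussian.map_rotation_eq_self (μ := gam) h0 (-(Real.pi / 4))
  convert h using 2
  funext x
  have h2 : (Real.sqrt 2 : ℂ) / 2 = 1 / (Real.sqrt 2 : ℂ) := by
    rw [div_eq_div_iff (by simp) sqrt_two_ne, sqrt_two_mul, one_mul]
  simp only [ContinuousLinearMap.rotation_apply, Real.cos_neg, Real.sin_neg, Real.cos_pi_div_four,
    Real.sin_pi_div_four, Complex.real_smul, neg_neg]
  push_cast
  rw [Prod.mk.injEq, h2]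
  constructor <;> ring

lemma indepFun_branchX (k : ℕ) :
    IndepFun (restrictLevel k ∘ branchX)
      (fun (ω : Option (List Bool) → ℂ) (t : Fin k → Bool) => ω (some (List.ofFn t)))
      (Measure.infinitePi fun _ : Option (List Bool) => gam) := by
  classical
  let S : Finset (Option (List Bool)) := insert none
    (((Finset.univ : Finset (Fin k → Bool)) ×ˢ Finset.range k).image
      fun x => some ((List.ofFn x.1).take x.2))
  let T : Finset (Option (List Bool)) :=
    (Finset.univ : Finset (Fin k → Bool)).image fun t => some (List.ofFn t)
  have hST : Disjoint S T := by
    rw [Finset.disjoint_left]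
    intro o hoS hoT
    obtain ⟨t, -, rfl⟩ := Finset.mem_image.1 hoT
    rcases Finset.mem_insert.1 hoS with h | h
    · simp at h
    · obtain ⟨x, hx, hxt⟩ := Finset.mem_image.1 h
      have h1 := congrArg List.length (Option.some_injective _ hxt)
      have h2 : x.2 < k := by simpa using hx
      simp at h1
      omega
  have hS0 : none ∈ S := Finset.mem_insert_self _ _
  have hS1 : ∀ (t : Fin k → Bool) (i : ℕ), i < k → some ((List.ofFn t).take i) ∈ S :=
    fun t i hi => Finset.mem_insert_of_mem (Finset.mem_image.2 ⟨(t, i), by simpa using hi, rfl⟩)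
  have hT : ∀ t : Fin k → Bool, some (List.ofFn t) ∈ T :=
    fun t => Finset.mem_image_of_mem _ (Finset.mem_univ t)
  clear_value S T
  have hI := (iIndepFun_infinitePi (P := fun _ : Option (List Bool) => gam)
    (X := fun _ z => z) (fun _ => measurable_id)).indepFun_finset S T hST
    (fun i => measurable_pi_apply i)
  let E : (S → ℂ) → Option (List Bool) → ℂ := fun y o => if h : o ∈ S then y ⟨o, h⟩ else 0
  have hE : Measurable E := by
    refine measurable_pi_lambda _ fun o => ?_
    by_cases h : o ∈ S
    · simp only [E, h, dite_true]
      exact measurable_pi_apply (⟨o, h⟩ : S)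
    · simp only [E, h, dite_false]
      exact measurable_const
  have h := hI.comp (((measurable_restrictLevel k).comp measurable_branchX).comp hE)
    (measurable_pi_lambda (fun (y : T → ℂ) t => y ⟨some (List.ofFn t), hT t⟩)
      fun t => measurable_pi_apply (⟨some (List.ofFn t), hT t⟩ : T))
  have hXe : restrictLevel k ∘ branchX =
      ((restrictLevel k ∘ branchX) ∘ E) ∘ fun ω (i : S) => ω i := by
    funext ω t
    simp only [Function.comp, restrictLevel, branchX, branch, E]
    rw [dif_pos hS0]
    congr 2
    refine Finset.sum_congr rfl fun i hi => ?_
    have hi : i < k := by simpa using hi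
    rw [dif_pos (hS1 t i hi)]
  rw [hXe]
  exact h

/-- The characterization of `gamInf`. -/
theorem map_restrictLevel_gamInf (k : ℕ) :
    gamInf.map (restrictLevel k) = Measure.pi fun _ => gam := by
  unfold gamInf
  rw [Measure.map_map (measurable_restrictLevel k) measurable_branchX]
  induction k with
  | zero =>
    have h := measurePreserving_eval_infinitePi (fun _ : Option (List Bool) => gam) none
    refine (Measure.pi_eq fun s hs => ?_).symm
    rw [Measure.map_apply ((measurable_restrictLevel 0).comp measurable_branchX)
      (MeasurableSet.univ_pi hs), Fintype.prod_unique]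
    refine Eq.trans ?_ (h.measure_preimage (hs _).nullMeasurableSet)
    congr 1
    ext ω
    simp [restrictLevel, branchX, branch, Unique.forall_iff]
  | succ k ih =>
    set P := Measure.infinitePi fun _ : Option (List Bool) => gam with hP
    set X := restrictLevel k ∘ branchX with hX
    have hXm : Measurable X := (measurable_restrictLevel k).comp measurable_branchX
    let Y : (Option (List Bool) → ℂ) → (Fin k → Bool) → ℂ := fun ω t => ω (some (List.ofFn t))
    have hYm : Measurable Y := by fun_prop
    have hYlaw : P.map Y = Measure.pi fun _ => gam := by
      have h := Measure.map_infinitePi_infinitePi_of_inj (P := fun _ : Option (List Bool) => gam)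
        (f := fun t : Fin k → Bool => some (List.ofFn t))
        (fun t t' h => List.ofFn_injective (Option.some_injective _ h))
      exact h.trans (Measure.infinitePi_eq_pi _)
    have hind : IndepFun X Y P := indepFun_branchX k
    have hlaw : P.map (fun ω => (X ω, Y ω)) =
        (Measure.pi fun _ : Fin k → Bool => gam).prod (Measure.pi fun _ => gam) := by
      rw [hind.map_prod_eq_prod_map_map hXm.aemeasurable hYm.aemeasurable, ih, hYlaw]
    refine (Measure.pi_eq fun s hs => ?_).symm
    rw [Measure.map_apply ((measurable_restrictLevel (k + 1)).comp measurable_branchX)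
      (MeasurableSet.univ_pi hs)]
    let R : ℂ × ℂ → ℂ × ℂ := fun x =>
      ((x.1 - x.2) / (Real.sqrt 2 : ℂ), (x.1 + x.2) / (Real.sqrt 2 : ℂ))
    have hRm : Measurable R := by fun_prop
    have hR : MeasurePreserving R (gam.prod gam) (gam.prod gam) := ⟨hRm, map_rotation_gam⟩
    have hpi := (measurePreserving_pi (fun _ : Fin k → Bool => gam.prod gam)
      (fun _ => gam.prod gam) (fun _ => hR)).comp
      (measurePreserving_arrowProdEquivProdArrow ℂ ℂ (Fin k → Bool) (fun _ => gam)
        (fun _ => gam)).symm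
    have htot := hpi.comp (f := fun ω => (X ω, Y ω)) (μa := P) ⟨hXm.prodMk hYm, hlaw⟩
    let B : (Fin k → Bool) → Set (ℂ × ℂ) := fun t =>
      s (Fin.snoc (α := fun _ => Bool) t false) ×ˢ s (Fin.snoc (α := fun _ => Bool) t true)
    have hB : ∀ t, MeasurableSet (B t) := fun t => (hs _).prod (hs _)
    have h1 := htot.measure_preimage (MeasurableSet.univ_pi hB).nullMeasurableSet
    have hprod : ∏ t, gam (s t) = ∏ t, (gam.prod gam) (B t) := by
      rw [← (Fin.snocEquiv fun _ : Fin (k + 1) => Bool).prod_comp, Fintype.prod_prod_type,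
        Fintype.prod_bool, mul_comm, ← Finset.prod_mul_distrib]
      refine Finset.prod_congr rfl fun t _ => ?_
      rw [Measure.prod_prod]
      rfl
    rw [Measure.pi_pi, ← hprod] at h1
    rw [← h1]
    congr 1
    ext ω
    have key : ∀ (t : Fin k → Bool) (b : Bool),
        branch ω (List.ofFn (Fin.snoc (α := fun _ => Bool) t b)) =
          (X ω t + (if b then 1 else -1) * Y ω t) / (Real.sqrt 2 : ℂ) := by
      intro t b
      rw [List.ofFn_succ']
      simp only [Fin.snoc_castSucc, Fin.snoc_last, List.concat_eq_append]
      rw [branch_append]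
      rfl
    have hall : (∀ t : Fin (k + 1) → Bool, branch ω (List.ofFn t) ∈ s t) ↔
        ∀ t : Fin k → Bool, ∀ b : Bool,
          branch ω (List.ofFn (Fin.snoc (α := fun _ => Bool) t b)) ∈
            s (Fin.snoc (α := fun _ => Bool) t b) := by
      constructor
      · exact fun h t b => h _
      · intro h t
        have := h (Fin.init t) (t (Fin.last k))
        rwa [Fin.snoc_init_self] at this
    have hL : ω ∈ (restrictLevel (k + 1) ∘ branchX) ⁻¹' Set.univ.pi s ↔
        ∀ t : Fin (k + 1) → Bool, branch ω (List.ofFn t) ∈ s t := by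
      simp [restrictLevel, branchX]
    rw [hL, hall]
    simp only [key, Bool.forall_bool]
    simp [B, R, MeasurableEquiv.arrowProdEquivProdArrow, Equiv.arrowProdEquivProdArrow,
      sub_eq_add_neg]

/-- Uniqueness in the characterization of `gamInf`. -/
theorem eq_gamInf_of_map_restrictLevel (ν : Measure XInf)
    (h : ∀ k, ν.map (restrictLevel k) = Measure.pi fun _ => gam) : ν = gamInf := by
  have hfin : IsFiniteMeasure ν := by
    refine ⟨?_⟩
    have := congrArg (fun m => m Set.univ) (h 0)
    simp only [Measure.map_apply (measurable_restrictLevel 0) MeasurableSet.univ,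
      Set.preimage_univ, measure_univ] at this
    rw [this]
    exact ENNReal.one_lt_top
  let m : ℕ → MeasurableSpace XInf := fun k => MeasurableSpace.comap (restrictLevel k) inferInstance
  have hmono : Monotone m := by
    refine monotone_nat_of_le_succ fun k => ?_
    let D : ((Fin (k + 1) → Bool) → ℂ) → (Fin k → Bool) → ℂ := fun y t =>
      (y (Fin.snoc (α := fun _ => Bool) t false) +
        y (Fin.snoc (α := fun _ => Bool) t true)) / (Real.sqrt 2 : ℂ)
    have hD : Measurable D := by fun_prop
    have he : restrictLevel k = D ∘ restrictLevel (k + 1) := by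
      funext f t
      simp only [Function.comp, D, restrictLevel, List.ofFn_succ', Fin.snoc_castSucc,
        Fin.snoc_last, List.concat_eq_append]
      exact f.2 _
    change MeasurableSpace.comap (restrictLevel k) _ ≤ _
    rw [he, ← MeasurableSpace.comap_comp]
    exact MeasurableSpace.comap_mono hD.comap_le
  have hgen : (inferInstance : MeasurableSpace XInf) = ⨆ k, m k := by
    refine le_antisymm ?_ (iSup_le fun k => (measurable_restrictLevel k).comap_le)
    have h1 : ∀ s : List Bool, Measurable[⨆ k, m k] fun f : XInf => f s := by
      intro s
      have h2 : Measurable[m s.length] fun f : XInf => f s := by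
        have h3 : (fun f : XInf => f s) =
            (fun y : (Fin s.length → Bool) → ℂ => y s.get) ∘ restrictLevel s.length := by
          funext f
          simp [restrictLevel]
        rw [h3]
        exact (measurable_pi_apply _).comp (comap_measurable _)
      exact h2.mono (le_iSup m _) le_rfl
    have h4 : Measurable[⨆ k, m k] (Subtype.val : XInf → List Bool → ℂ) :=
      @measurable_pi_lambda _ _ _ (⨆ k, m k) _ _ h1
    exact h4.comap_le
  refine ext_of_generate_finite (⋃ k, {s | MeasurableSet[m k] s}) ?_
    (isPiSystem_iUnion_of_monotone _ (fun k => (m k).isPiSystem_measurableSet)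
      fun i j hij s hs => hmono hij s hs) ?_ ?_
  · exact hgen.trans (MeasurableSpace.generateFrom_iUnion_measurableSet m).symm
  · intro s hs
    obtain ⟨k, A, hA, rfl⟩ := Set.mem_iUnion.1 hs
    rw [← Measure.map_apply (measurable_restrictLevel k) hA,
      ← Measure.map_apply (measurable_restrictLevel k) hA, h, map_restrictLevel_gamInf]
  · have := congrArg (fun m => m Set.univ) (h 0)
    simpa [Measure.map_apply (measurable_restrictLevel 0) MeasurableSet.univ] using this

/-! ### Automorphisms of a measure space -/

section Automorphisms


variable {X : Type*} [TopologicalSpace X] [TopologicalSpace.MetrizableSpace X]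
  [SecondCountableTopology X] [MeasurableSpace X] [BorelSpace X]

/-- Measure preserving maps of `X` to itself, modulo equality almost everywhere. -/
def MPMap (μ : Measure X) : Type _ := {T : X →ₘ[μ] X // MeasurePreserving T μ μ}

instance (μ : Measure X) : CoeFun (MPMap μ) fun _ => X → X := ⟨fun T => T.1⟩

lemma MPMap.ext {μ : Measure X} {S T : MPMap μ} (h : (S : X → X) =ᵐ[μ] T) : S = T :=
  Subtype.ext (AEEqFun.ext h)

/-- The product is composition: `S * T` is `x ↦ S (T x)`. -/
instance (μ : Measure X) : Mul (MPMap μ) where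
  mul S T := ⟨S.1.compMeasurePreserving T T.2,
    (S.2.comp T.2).congr (S.1.compMeasurePreserving T T.2).stronglyMeasurable.measurable
      (AEEqFun.coeFn_compMeasurePreserving S.1 T.2).symm⟩

instance (μ : Measure X) : One (MPMap μ) where
  one := ⟨AEEqFun.mk id measurable_id.aestronglyMeasurable,
    (MeasurePreserving.id μ).congr (AEEqFun.stronglyMeasurable _).measurable
      (AEEqFun.coeFn_mk _ _).symm⟩

lemma MPMap.coe_mul {μ : Measure X} (S T : MPMap μ) :
    ((S * T : MPMap μ) : X → X) =ᵐ[μ] (S : X → X) ∘ T :=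
  AEEqFun.coeFn_compMeasurePreserving S.1 T.2

lemma MPMap.coe_one (μ : Measure X) : ((1 : MPMap μ) : X → X) =ᵐ[μ] id :=
  AEEqFun.coeFn_mk _ _

instance (μ : Measure X) : Monoid (MPMap μ) where
  mul_assoc R S T := by
    refine MPMap.ext ?_
    have h1 := T.2.quasiMeasurePreserving.ae_eq_comp (MPMap.coe_mul R S)
    have h2 := (MPMap.coe_mul S T).fun_comp R
    exact ((MPMap.coe_mul (R * S) T).trans h1).trans
      (h2.symm.trans (MPMap.coe_mul R (S * T)).symm)
  one_mul T := MPMap.ext <| (MPMap.coe_mul 1 T).trans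
    (T.2.quasiMeasurePreserving.ae_eq_comp (MPMap.coe_one μ))
  mul_one T := MPMap.ext <| (MPMap.coe_mul T 1).trans ((MPMap.coe_one μ).fun_comp T)

/-- The group of invertible measure preserving transformations of `X`, modulo equality almost
everywhere. -/
abbrev Aut (μ : Measure X) : Type _ := (MPMap μ)ˣ

/-- The weak topology on the group of measure preserving transformations: the coarsest one for
which `T ↦ μ (T ⁻¹ A ∆ B)` is continuous for all measurable sets `A`, `B`. -/
instance (μ : Measure X) : TopologicalSpace (Aut μ) :=
  ⨅ (A : {A : Set X // MeasurableSet A}) (B : {B : Set X // MeasurableSet B}),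
    TopologicalSpace.induced (fun T : Aut μ => μ (((T : MPMap μ) ⁻¹' A.1) ∆ B.1)) inferInstance

end Automorphisms

/-! ### The boolean action -/

/-- The action on `XInf` of the step function of level `n` with values `c`. For a sequence `s` of
length at least `n`, the value of the step function on the cylinder `[s]` is `c` applied to the
first `n` digits of `s`. -/
def stepActFun {n : ℕ} (c : (Fin n → Bool) → Circle) (f : List Bool → ℂ) (s : List Bool) : ℂ :=
  if n ≤ s.length then ((c fun i : Fin n => s.getD i false : Circle) : ℂ) * f s
  else (∑ t : Fin (n - s.length) → Bool,
    ((c fun i : Fin n => (s ++ List.ofFn t).getD i false : Circle) : ℂ) * f (s ++ List.ofFn t)) /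
      (Real.sqrt 2 : ℂ) ^ (n - s.length)

lemma sum_split (h : List Bool → ℂ) (k : ℕ) (s : List Bool) :
    ∑ t : Fin (k + 1) → Bool, h (s ++ List.ofFn t) =
      ∑ t : Fin k → Bool, h (s ++ [false] ++ List.ofFn t) +
        ∑ t : Fin k → Bool, h (s ++ [true] ++ List.ofFn t) := by
  rw [← (Fin.consEquiv fun _ : Fin (k + 1) => Bool).sum_comp, Fintype.sum_prod_type,
    Fintype.sum_bool, add_comm]
  simp [Fin.consEquiv, List.ofFn_succ]

lemma stepActFun_of_le {n : ℕ} (c : (Fin n → Bool) → Circle) (f : List Bool → ℂ) (s : List Bool)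
    {k : ℕ} (hk : n = s.length + k) :
    stepActFun c f s = (∑ t : Fin k → Bool,
      ((c fun i : Fin n => (s ++ List.ofFn t).getD i false : Circle) : ℂ) * f (s ++ List.ofFn t)) /
        (Real.sqrt 2 : ℂ) ^ k := by
  obtain rfl : k = n - s.length := by omega
  unfold stepActFun
  split_ifs with h
  · have h0 : n - s.length = 0 := by omega
    generalize n - s.length = k at h0
    subst h0
    simp
  · rfl

/-- The action of step functions on `XInf`. -/
def stepAct {n : ℕ} (c : (Fin n → Bool) → Circle) (f : XInf) : XInf :=
  ⟨stepActFun c f, fun s => by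
    have hs := sqrt_two_ne
    by_cases h : n ≤ s.length
    · have h1 : ∀ b, (fun i : Fin n => (s ++ [b]).getD i false) = fun i : Fin n => s.getD i false := by
        intro b
        funext i
        rw [List.getD_append _ _ _ _ (i.2.trans_le h)]
      have h2 : ∀ b : Bool, n ≤ (s ++ [b]).length := fun b => by simp; omega
      simp only [stepActFun, if_pos h, if_pos (h2 _), h1]
      rw [f.2 s]
      ring
    · obtain ⟨k, hk⟩ : ∃ k, n = s.length + (k + 1) := ⟨n - s.length - 1, by omega⟩
      have h2 : ∀ b : Bool, n = (s ++ [b]).length + k := fun b => by simp; omega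
      rw [stepActFun_of_le c f s hk, stepActFun_of_le c f _ (h2 _),
        stepActFun_of_le c f _ (h2 _),
        sum_split (fun u => ((c fun i : Fin n => u.getD i false : Circle) : ℂ) * f u), pow_succ]
      field_simp⟩

/-- A boolean action of `L0` on `(XInf, gamInf)`, i.e. a homomorphism into the group of
automorphisms, is the Gaussian one if it is continuous and extends the action of step functions. -/
def IsGaussianAction (Θ : L0 →* Aut gamInf) : Prop :=
  Continuous Θ ∧
    ∀ (n : ℕ) (c : (Fin n → Bool) → Circle), ⇑(Θ (step c) : MPMap gamInf) =ᵐ[gamInf] stepAct c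

/-! ### Unitary representations -/

section Representations

variable {G : Type*} [Group G]

/-- Representations of `G` by unitary operators on a Hilbert space `H`. -/
abbrev UnitaryRep (G : Type*) [Group G] (H : Type*) [NormedAddCommGroup H]
    [InnerProductSpace ℂ H] : Type _ := G →* (H ≃ₗᵢ[ℂ] H)

/-- A multiplicative family of isometries indexed by a group consists of unitary operators. -/
def UnitaryRep.ofIsometry {H : Type*} [NormedAddCommGroup H] [InnerProductSpace ℂ H]
    (ρ : G →* (H →ₗᵢ[ℂ] H)) : UnitaryRep G H where
  toFun g :=
    { toFun := ρ g
      invFun := ρ g⁻¹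
      map_add' := (ρ g).map_add
      map_smul' := (ρ g).map_smul
      norm_map' := (ρ g).norm_map
      left_inv := fun v => by
        change (ρ g⁻¹ * ρ g) v = v
        rw [← map_mul, inv_mul_cancel, map_one]; rfl
      right_inv := fun v => by
        change (ρ g * ρ g⁻¹) v = v
        rw [← map_mul, mul_inv_cancel, map_one]; rfl }
  map_one' := by
    ext v
    change ρ 1 v = v
    rw [map_one]; rfl
  map_mul' g h := by
    ext v
    change ρ (g * h) v = ρ g (ρ h v)
    rw [map_mul]; rfl

/-- Restriction of a unitary representation to an invariant subspace. -/
def UnitaryRep.restrict {H : Type*} [NormedAddCommGroup H] [InnerProductSpace ℂ H]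
    (ρ : UnitaryRep G H) (V : Submodule ℂ H) (hV : ∀ g, ∀ v ∈ V, ρ g v ∈ V) :
    UnitaryRep G V :=
  UnitaryRep.ofIsometry
    { toFun := fun g =>
        { toLinearMap := (ρ g).toLinearEquiv.toLinearMap.restrict (hV g)
          norm_map' := fun v => (ρ g).norm_map v }
      map_one' := by
        ext v
        change ρ 1 (v : H) = v
        rw [map_one]; rfl
      map_mul' := fun g h => by
        ext v
        change ρ (g * h) (v : H) = ρ g (ρ h v)
        rw [map_mul]; rfl }

/-- The `ℓ²`-sum of unitary representations, acting coordinatewise. -/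
def UnitaryRep.ellTwoSum {ι : Type*} {H : ι → Type*} [∀ i, NormedAddCommGroup (H i)]
    [∀ i, InnerProductSpace ℂ (H i)] (ρ : ∀ i, UnitaryRep G (H i)) :
    UnitaryRep G (lp H 2) :=
  UnitaryRep.ofIsometry
    { toFun := fun g =>
        { toFun := fun v => ⟨fun i => ρ i g (v i), by
            have h : Memℓp (fun i => ρ i g (v i)) 2 := by
              have h := lp.memℓp v
              rw [memℓp_gen_iff (by norm_num)] at h ⊢
              simpa using h
            exact h⟩
          map_add' := fun v w => by ext i; exact (ρ i g).map_add (v i) (w i)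
          map_smul' := fun c v => by ext i; exact (ρ i g).map_smul c (v i)
          norm_map' := fun v => by
            rw [lp.norm_eq_tsum_rpow (by norm_num), lp.norm_eq_tsum_rpow (by norm_num)]
            simp }
      map_one' := by ext v i; simp
      map_mul' := fun g h => by ext v i; simp }

/-- Two unitary representations are isomorphic if there is an equivariant isomorphism of Hilbert
spaces between them. -/
def UnitaryRep.Isomorphic {H K : Type*} [NormedAddCommGroup H] [InnerProductSpace ℂ H]
    [NormedAddCommGroup K] [InnerProductSpace ℂ K] (ρ : UnitaryRep G H) (ρ' : UnitaryRep G K) :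
    Prop :=
  ∃ Φ : H ≃ₗᵢ[ℂ] K, ∀ (g : G) (v : H), Φ (ρ g v) = ρ' g (Φ v)

end Representations

/-! ### The Koopman representation -/

section Koopman

variable {X : Type*} [TopologicalSpace X] [TopologicalSpace.MetrizableSpace X]
  [SecondCountableTopology X] [MeasurableSpace X] [BorelSpace X]

/-- The Koopman representation: the automorphism `T` acts on `L²` by `f ↦ f ∘ T⁻¹`. -/
def koopman (μ : Measure X) : UnitaryRep (Aut μ) (Lp ℂ 2 μ) :=
  UnitaryRep.ofIsometry
    { toFun := fun T => Lp.compMeasurePreservingₗᵢ ℂ ((T⁻¹ : Aut μ) : MPMap μ)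
        ((T⁻¹ : Aut μ) : MPMap μ).2
      map_one' := by
        ext1 f
        refine Lp.ext ((Lp.coeFn_compMeasurePreserving f _).trans ?_)
        have h : ((((1 : Aut μ)⁻¹ : Aut μ) : MPMap μ) : X → X) =ᵐ[μ] id := by
          rw [inv_one]
          exact MPMap.coe_one μ
        exact h.fun_comp f
      map_mul' := fun S T => by
        ext1 f
        refine Lp.ext ((Lp.coeFn_compMeasurePreserving f _).trans ?_)
        have h : ((((S * T)⁻¹ : Aut μ) : MPMap μ) : X → X) =ᵐ[μ]
            (((T⁻¹ : Aut μ) : MPMap μ) : X → X) ∘ ((S⁻¹ : Aut μ) : MPMap μ) := by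
          rw [mul_inv_rev, Units.val_mul]
          exact MPMap.coe_mul _ _
        refine (h.fun_comp f).trans ?_
        have hT := Lp.coeFn_compMeasurePreserving f ((T⁻¹ : Aut μ) : MPMap μ).2
        have hS := Lp.coeFn_compMeasurePreserving
          (Lp.compMeasurePreserving _ ((T⁻¹ : Aut μ) : MPMap μ).2 f) ((S⁻¹ : Aut μ) : MPMap μ).2
        have hTS := ((S⁻¹ : Aut μ) : MPMap μ).2.quasiMeasurePreserving.ae_eq_comp hT
        exact (hS.trans hTS).symm }

/-- The subspace of constant functions in `L²`. -/
def constants (μ : Measure X) [IsFiniteMeasure μ] : Submodule ℂ (Lp ℂ 2 μ) :=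
  LinearMap.range (Lp.constₗ 2 μ ℂ : ℂ →ₗ[ℂ] Lp ℂ 2 μ)

lemma koopman_const (μ : Measure X) [IsFiniteMeasure μ] (T : Aut μ) (c : ℂ) :
    koopman μ T (Lp.const 2 μ c) = Lp.const 2 μ c := by
  refine Lp.ext ((Lp.coeFn_compMeasurePreserving (Lp.const 2 μ c) _).trans ?_)
  have h := Lp.coeFn_const (p := 2) (μ := μ) c
  exact (((T⁻¹ : Aut μ) : MPMap μ).2.quasiMeasurePreserving.ae_eq_comp h).trans h.symm

lemma koopman_mem_orthogonal (μ : Measure X) [IsFiniteMeasure μ] (T : Aut μ) (f : Lp ℂ 2 μ)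
    (hf : f ∈ (constants μ)ᗮ) : koopman μ T f ∈ (constants μ)ᗮ := by
  rw [Submodule.mem_orthogonal] at hf ⊢
  rintro _ ⟨c, rfl⟩
  have h := hf _ ⟨c, rfl⟩
  rw [← (koopman μ T).inner_map_map] at h
  simpa [koopman_const] using h

/-- The Koopman representation of a boolean action, restricted to the orthogonal complement of the
constant functions. -/
def koopmanZero {G : Type*} [Group G] {μ : Measure X} [IsFiniteMeasure μ] (Θ : G →* Aut μ) :
    UnitaryRep G ((constants μ)ᗮ : Submodule ℂ (Lp ℂ 2 μ)) :=
  UnitaryRep.restrict ((koopman μ).comp Θ) (constants μ)ᗮ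
    fun g f hf => koopman_mem_orthogonal μ (Θ g) f hf

end Koopman

/-! ### The multiplication representations -/

section Multiplication

variable {Y : Type*} [MeasurableSpace Y] {μ : Measure Y}

lemma memLp_circle_mul (u : Y →ₘ[μ] Circle) (f : Lp ℂ 2 μ) :
    MemLp (fun y => (u y : ℂ) * f y) 2 μ :=
  (Lp.memLp f).of_le
    (((continuous_subtype_val : Continuous ((↑) : Circle → ℂ)).comp_aestronglyMeasurable u.aestronglyMeasurable).mul
      (Lp.aestronglyMeasurable f))
    (ae_of_all _ fun y => by rw [norm_mul, Circle.norm_coe, one_mul])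

/-- Multiplication of `L²` functions by a unimodular function. -/
def circleMul (u : Y →ₘ[μ] Circle) : Lp ℂ 2 μ →ₗᵢ[ℂ] Lp ℂ 2 μ where
  toFun f := (memLp_circle_mul u f).toLp _
  map_add' f g := by
    refine Lp.ext ?_
    filter_upwards [(memLp_circle_mul u (f + g)).coeFn_toLp, (memLp_circle_mul u f).coeFn_toLp,
      (memLp_circle_mul u g).coeFn_toLp, Lp.coeFn_add f g,
      Lp.coeFn_add ((memLp_circle_mul u f).toLp _) ((memLp_circle_mul u g).toLp _)]
      with y h1 h2 h3 h4 h5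
    rw [h1, h5, Pi.add_apply, h2, h3, h4, Pi.add_apply, mul_add]
  map_smul' c f := by
    refine Lp.ext ?_
    filter_upwards [(memLp_circle_mul u (c • f)).coeFn_toLp, (memLp_circle_mul u f).coeFn_toLp,
      Lp.coeFn_smul c f, Lp.coeFn_smul c ((memLp_circle_mul u f).toLp _)] with y h1 h2 h3 h4
    rw [h1, RingHom.id_apply, h4, Pi.smul_apply, h2, h3, Pi.smul_apply, smul_eq_mul, smul_eq_mul,
      mul_left_comm]
  norm_map' f := by
    change ‖(memLp_circle_mul u f).toLp _‖ = ‖f‖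
    rw [Lp.norm_toLp, Lp.norm_def]
    congr 1
    exact eLpNorm_congr_norm_ae (ae_of_all _ fun y => by rw [norm_mul, Circle.norm_coe, one_mul])

lemma coeFn_circleMul (u : Y →ₘ[μ] Circle) (f : Lp ℂ 2 μ) :
    circleMul u f =ᵐ[μ] fun y => (u y : ℂ) * f y :=
  (memLp_circle_mul u f).coeFn_toLp

/-- The action of unimodular functions on `L²` by multiplication. -/
def mulRep (μ : Measure Y) : UnitaryRep (Y →ₘ[μ] Circle) (Lp ℂ 2 μ) :=
  UnitaryRep.ofIsometry
    { toFun := circleMul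
      map_one' := by
        ext1 f
        refine Lp.ext ?_
        filter_upwards [coeFn_circleMul (1 : Y →ₘ[μ] Circle) f,
          AEEqFun.coeFn_one (α := Y) (μ := μ) (β := Circle)] with y h1 h2
        rw [h1, h2]
        simp
      map_mul' := fun u v => by
        ext1 f
        refine Lp.ext ?_
        filter_upwards [coeFn_circleMul (u * v) f, coeFn_circleMul u (circleMul v f),
          coeFn_circleMul v f, AEEqFun.coeFn_mul u v] with y h1 h2 h3 h4
        rw [h1, h4]
        change _ = circleMul u (circleMul v f) y
        rw [h2, h3, Pi.mul_apply, Circle.coe_mul, mul_assoc] }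

end Multiplication

/-- The space of pairs `(a, b)` of a sequence of `p` and a sequence of `q` points. -/
abbrev CSpace (p q : ℕ) : Type := (Fin p → Cantor) × (Fin q → Cantor)

/-- The product of `p + q` copies of `lam`. -/
def muPQ (p q : ℕ) : Measure (CSpace p q) :=
  (Measure.pi fun _ => lam).prod (Measure.pi fun _ => lam)

instance (p q : ℕ) : IsProbabilityMeasure (muPQ p q) := by
  unfold muPQ; infer_instance

lemma mp_fst (p q : ℕ) (i : Fin p) :
    MeasurePreserving (fun x : CSpace p q => x.1 i) (muPQ p q) lam :=
  (measurePreserving_eval (fun _ => lam) i).comp measurePreserving_fst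

lemma mp_snd (p q : ℕ) (j : Fin q) :
    MeasurePreserving (fun x : CSpace p q => x.2 j) (muPQ p q) lam :=
  (measurePreserving_eval (fun _ => lam) j).comp measurePreserving_snd

lemma mp_comp_perm (n : ℕ) (σ : Equiv.Perm (Fin n)) :
    MeasurePreserving (fun a : Fin n → Cantor => a ∘ σ) (Measure.pi fun _ => lam)
      (Measure.pi fun _ => lam) := by
  have h := measurePreserving_piCongrLeft (fun _ : Fin n => lam) σ⁻¹
  convert h using 1
  funext a i
  simp [MeasurableEquiv.piCongrLeft, Equiv.piCongrLeft_apply]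
  rfl

lemma mp_perm (p q : ℕ) (σ : Equiv.Perm (Fin p)) (τ : Equiv.Perm (Fin q)) :
    MeasurePreserving (fun x : CSpace p q => (x.1 ∘ σ, x.2 ∘ τ)) (muPQ p q) (muPQ p q) :=
  (mp_comp_perm p σ).prod (mp_comp_perm q τ)

/-- The function `g(a₁) ⋯ g(a_p) g(b₁)⁻¹ ⋯ g(b_q)⁻¹`. -/
def rFun (p q : ℕ) (g : Cantor → Circle) (x : CSpace p q) : Circle :=
  (∏ i, g (x.1 i)) * ∏ j, (g (x.2 j))⁻¹

lemma aestronglyMeasurable_rFun (p q : ℕ) (g : L0) :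
    AEStronglyMeasurable (rFun p q g) (muPQ p q) := by
  unfold rFun
  refine AEStronglyMeasurable.mul ?_ ?_
  · exact Finset.aestronglyMeasurable_fun_prod _ fun i _ =>
      g.aestronglyMeasurable.comp_measurePreserving (mp_fst p q i)
  · exact Finset.aestronglyMeasurable_fun_prod _ fun j _ =>
      (g.aestronglyMeasurable.comp_measurePreserving (mp_snd p q j)).inv

lemma rFun_congr (p q : ℕ) {g h : Cantor → Circle} (hgh : g =ᵐ[lam] h) :
    rFun p q g =ᵐ[muPQ p q] rFun p q h := by
  have h1 : ∀ᵐ x ∂muPQ p q, ∀ i, g (x.1 i) = h (x.1 i) :=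
    ae_all_iff.2 fun i => (mp_fst p q i).quasiMeasurePreserving.ae_eq_comp hgh
  have h2 : ∀ᵐ x ∂muPQ p q, ∀ j, g (x.2 j) = h (x.2 j) :=
    ae_all_iff.2 fun j => (mp_snd p q j).quasiMeasurePreserving.ae_eq_comp hgh
  filter_upwards [h1, h2] with x hx1 hx2
  simp [rFun, hx1, hx2]

/-- The class of `g(a₁) ⋯ g(a_p) g(b₁)⁻¹ ⋯ g(b_q)⁻¹`, as a homomorphism in `g`. -/
def rMap (p q : ℕ) : L0 →* (CSpace p q →ₘ[muPQ p q] Circle) where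
  toFun g := AEEqFun.mk (rFun p q g) (aestronglyMeasurable_rFun p q g)
  map_one' := by
    refine AEEqFun.ext ((AEEqFun.coeFn_mk _ _).trans ?_)
    filter_upwards [rFun_congr p q (AEEqFun.coeFn_one (α := Cantor) (μ := lam) (β := Circle)),
      AEEqFun.coeFn_one (α := CSpace p q) (μ := muPQ p q) (β := Circle)] with x h1 h2
    rw [h1, h2]
    simp [rFun]
  map_mul' g h := by
    refine AEEqFun.ext ((AEEqFun.coeFn_mk _ _).trans ?_)
    filter_upwards [rFun_congr p q (AEEqFun.coeFn_mul g h),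
      AEEqFun.coeFn_mul (AEEqFun.mk (rFun p q g) (aestronglyMeasurable_rFun p q g))
        (AEEqFun.mk (rFun p q h) (aestronglyMeasurable_rFun p q h)),
      AEEqFun.coeFn_mk (rFun p q g) (aestronglyMeasurable_rFun p q g),
      AEEqFun.coeFn_mk (rFun p q h) (aestronglyMeasurable_rFun p q h)] with x h1 h2 h3 h4
    rw [h1, h2, Pi.mul_apply, h3, h4]
    simp only [rFun, Pi.mul_apply, mul_inv, Finset.prod_mul_distrib]
    exact mul_mul_mul_comm _ _ _ _

/-- The subspace of `L²` of functions invariant under permutations of the first `p` and of the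
last `q` coordinates. -/
def symL2 (p q : ℕ) : Submodule ℂ (Lp ℂ 2 (muPQ p q)) where
  carrier := {f | ∀ σ τ, Lp.compMeasurePreserving _ (mp_perm p q σ τ) f = f}
  zero_mem' := fun σ τ => map_zero _
  add_mem' := fun hf hg σ τ => by rw [map_add, hf σ τ, hg σ τ]
  smul_mem' := fun c f hf σ τ =>
    ((Lp.compMeasurePreservingₗ ℂ _ (mp_perm p q σ τ)).map_smul c f).trans
      (congrArg (c • ·) (hf σ τ))

lemma mulRep_mem_symL2 (p q : ℕ) (g : L0) (f : Lp ℂ 2 (muPQ p q)) (hf : f ∈ symL2 p q) :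
    mulRep (muPQ p q) (rMap p q g) f ∈ symL2 p q := by
  intro σ τ
  have hm := coeFn_circleMul (rMap p q g) f
  have hr : rMap p q g =ᵐ[muPQ p q] rFun p q g := AEEqFun.coeFn_mk _ _
  have hf' := Lp.coeFn_compMeasurePreserving f (mp_perm p q σ τ)
  rw [hf σ τ] at hf'
  have hq := (mp_perm p q σ τ).quasiMeasurePreserving
  change Lp.compMeasurePreserving _ (mp_perm p q σ τ) (circleMul (rMap p q g) f) =
    circleMul (rMap p q g) f
  refine Lp.ext ?_
  filter_upwards [Lp.coeFn_compMeasurePreserving (circleMul (rMap p q g) f) (mp_perm p q σ τ),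
    hm, hq.ae_eq_comp hm, hr, hq.ae_eq_comp hr, hf'] with x h1 h2 h3 h4 h5 h6
  rw [h1, h3, h2, h6, h4]
  simp only [Function.comp] at h5 ⊢
  rw [h5]
  congr 2
  simp only [rFun, Function.comp]
  rw [Equiv.prod_comp σ fun i => g (x.1 i), Equiv.prod_comp τ fun j => (g (x.2 j))⁻¹]

/-- The representation of `L0` on symmetric functions by multiplication with
`g(a₁) ⋯ g(a_p) g(b₁)⁻¹ ⋯ g(b_q)⁻¹`. -/
def rho (p q : ℕ) : UnitaryRep L0 (symL2 p q) :=
  UnitaryRep.restrict ((mulRep (muPQ p q)).comp (rMap p q)) (symL2 p q)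
    fun g f hf => mulRep_mem_symL2 p q g f hf

end KoopmanL0

end

/-!
The coordinates `f ↦ f s` have in `L²(γ_∞)` the same inner products as the normalized cylinder
indicators `2 ^ (|s| / 2) 1_[s]` in `L²(λ)`, and both families branch in the same way, so there is
an isometric embedding of `L²(λ)` into `L²(γ_∞)` by complex Gaussian variables. Every isometry `U`
of `L²(λ)` therefore induces a measure preserving transformation of `X_∞`, contravariantly in `U`
and determined by its effect on the functions `W x = exp (2 i Re x)` of these variables, which are
total in `L²(γ_∞)`. The action `Θ` comes from the commuting operators of multiplication by `g`; it
is unique because the step functions are dense in `L⁰(λ, 𝕋)`.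

The vectors `exp (‖h‖²) W h` have the Gram matrix `exp (⟪h, k⟫ + ⟪k, h⟫)`. Expanding the two
exponentials, this is also the Gram matrix of the vectors with the components
`(p! q!)^(-1/2) h̄^{⊗p} ⊗ h^{⊗q}`, which are total in the sum of the spaces of symmetric functions
by polarization and because the coefficients of a power series in `z` and `z̄` are determined by
its sum. Matching the two families, with the constants (`p = q = 0`) removed, gives the isomorphism:
in both representations `g` sends the vector of `h` to the vector of `g⁻¹ h`.
-/

section

open Filter Topology Polynomial
open scoped InnerProductSpace ComplexConjugate NNReal

noncomputable section

namespace KoopmanL0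

/-! ### Total families in Hilbert spaces -/

section Total

variable {𝕜 ι H K : Type*} [RCLike 𝕜] [NormedAddCommGroup H] [InnerProductSpace 𝕜 H]
  [NormedAddCommGroup K] [InnerProductSpace 𝕜 K] {e : ι → H} {f : ι → K}

lemma inner_linearCombination_eq (hef : ∀ i j, ⟪e i, e j⟫_𝕜 = ⟪f i, f j⟫_𝕜) (c d : ι →₀ 𝕜) :
    ⟪Finsupp.linearCombination 𝕜 e c, Finsupp.linearCombination 𝕜 e d⟫_𝕜 =
      ⟪Finsupp.linearCombination 𝕜 f c, Finsupp.linearCombination 𝕜 f d⟫_𝕜 := by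
  simp only [Finsupp.linearCombination_apply, Finsupp.sum, sum_inner, inner_sum, inner_smul_left,
    inner_smul_right, hef]

lemma norm_linearCombination_eq (hef : ∀ i j, ⟪e i, e j⟫_𝕜 = ⟪f i, f j⟫_𝕜) (c : ι →₀ 𝕜) :
    ‖Finsupp.linearCombination 𝕜 f c‖ = ‖Finsupp.linearCombination 𝕜 e c‖ := by
  rw [@norm_eq_sqrt_re_inner 𝕜, @norm_eq_sqrt_re_inner 𝕜, inner_linearCombination_eq hef]

lemma exists_linearIsometry_of_inner_eq [CompleteSpace K]
    (hef : ∀ i j, ⟪e i, e j⟫_𝕜 = ⟪f i, f j⟫_𝕜)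
    (he : (Submodule.span 𝕜 (Set.range e)).topologicalClosure = ⊤) :
    ∃ U : H →ₗᵢ[𝕜] K, ∀ i, U (e i) = f i := by
  have hd : DenseRange (Finsupp.linearCombination 𝕜 e) := by
    have h := Submodule.dense_iff_topologicalClosure_eq_top.2 he
    rwa [← Finsupp.range_linearCombination] at h
  have hn (c) : ‖Finsupp.linearCombination 𝕜 f c‖ ≤ 1 * ‖Finsupp.linearCombination 𝕜 e c‖ := by
    rw [one_mul, norm_linearCombination_eq hef]
  let U := (Finsupp.linearCombination 𝕜 f).extendOfNorm (Finsupp.linearCombination 𝕜 e)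
  have hU : ∀ c, U (Finsupp.linearCombination 𝕜 e c) = Finsupp.linearCombination 𝕜 f c :=
    LinearMap.extendOfNorm_eq hd ⟨1, hn⟩
  refine ⟨⟨U.toLinearMap, fun x => ?_⟩, fun i => ?_⟩
  · refine hd.induction_on (p := fun x => ‖U x‖ = ‖x‖) x
      (isClosed_eq (by fun_prop) (by fun_prop)) fun c => ?_
    rw [hU, norm_linearCombination_eq hef]
  · simpa using hU (Finsupp.single i 1)

lemma exists_linearIsometryEquiv_of_inner_eq [CompleteSpace H] [CompleteSpace K]
    (hef : ∀ i j, ⟪e i, e j⟫_𝕜 = ⟪f i, f j⟫_𝕜)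
    (he : (Submodule.span 𝕜 (Set.range e)).topologicalClosure = ⊤)
    (hf : (Submodule.span 𝕜 (Set.range f)).topologicalClosure = ⊤) :
    ∃ U : H ≃ₗᵢ[𝕜] K, ∀ i, U (e i) = f i := by
  obtain ⟨U, hU⟩ := exists_linearIsometry_of_inner_eq hef he
  have hclosed : IsClosed (Set.range U) := U.isometry.isClosedEmbedding.isClosed_range
  have hspan : Submodule.span 𝕜 (Set.range f) ≤ LinearMap.range U.toLinearMap :=
    Submodule.span_le.2 (Set.range_subset_iff.2 fun i => ⟨e i, hU i⟩)
  have hrange := Submodule.topologicalClosure_minimal _ hspan hclosed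
  exact ⟨LinearIsometryEquiv.ofSurjective U fun y => hrange (hf ▸ Submodule.mem_top), hU⟩

lemma topologicalClosure_span_range_eq_top [CompleteSpace H]
    (h : ∀ v : H, (∀ i, ⟪e i, v⟫_𝕜 = 0) → v = 0) :
    (Submodule.span 𝕜 (Set.range e)).topologicalClosure = ⊤ := by
  rw [Submodule.topologicalClosure_eq_top_iff, Submodule.eq_bot_iff]
  intro v hv
  exact h v fun i => (Submodule.mem_orthogonal _ v).1 hv _ (Submodule.subset_span ⟨i, rfl⟩)

lemma linearIsometry_eq_of_total (he : (Submodule.span 𝕜 (Set.range e)).topologicalClosure = ⊤)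
    {S T : H →ₗᵢ[𝕜] K} (h : ∀ i, S (e i) = T (e i)) : S = T := by
  have hST : S.toContinuousLinearMap = T.toContinuousLinearMap :=
    ContinuousLinearMap.ext_on (Submodule.dense_iff_topologicalClosure_eq_top.2 he)
      (Set.forall_mem_range.2 h)
  exact LinearIsometry.ext fun x => congrArg (fun A : H →L[𝕜] K => A x) hST

lemma continuous_linearIsometry_apply_of_total {Y : Type*} [TopologicalSpace Y]
    (he : (Submodule.span 𝕜 (Set.range e)).topologicalClosure = ⊤) {S : Y → H →ₗᵢ[𝕜] K}
    (h : ∀ i, Continuous fun y => S y (e i)) (x : H) : Continuous fun y => S y x := by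
  have hspan (v) (hv : v ∈ Submodule.span 𝕜 (Set.range e)) : Continuous fun y => S y v := by
    induction hv using Submodule.span_induction with
    | mem v hv => obtain ⟨i, rfl⟩ := hv; exact h i
    | zero => simpa using continuous_const
    | add v w _ _ hv hw => simp only [map_add]; exact hv.add hw
    | smul c v _ hv => simp only [map_smul]; exact hv.const_smul c
  refine continuous_of_uniform_approx_of_continuous fun u hu => ?_
  obtain ⟨ε, hε, hεu⟩ := Metric.mem_uniformity_dist.1 hu
  obtain ⟨v, hv, hxv⟩ :=
    (Submodule.dense_iff_topologicalClosure_eq_top.2 he).exists_dist_lt x hε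
  exact ⟨fun y => S y v, hspan v hv, fun y => hεu (by rwa [(S y).dist_map])⟩

end Total

lemma UnitaryRep.isomorphic_of_total {G H K ι : Type*} [Group G]
    [NormedAddCommGroup H] [InnerProductSpace ℂ H] [CompleteSpace H]
    [NormedAddCommGroup K] [InnerProductSpace ℂ K] [CompleteSpace K]
    {ρ : UnitaryRep G H} {ρ' : UnitaryRep G K} {e : ι → H} {f : ι → K} {σ : G → ι → ι}
    (he : ∀ v, (∀ i, ⟪e i, v⟫_ℂ = 0) → v = 0) (hf : ∀ v, (∀ i, ⟪f i, v⟫_ℂ = 0) → v = 0)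
    (hef : ∀ i j, ⟪e i, e j⟫_ℂ = ⟪f i, f j⟫_ℂ) (hρ : ∀ g i, ρ g (e i) = e (σ g i))
    (hρ' : ∀ g i, ρ' g (f i) = f (σ g i)) : ρ.Isomorphic ρ' := by
  have htotal := topologicalClosure_span_range_eq_top he
  obtain ⟨Φ, hΦ⟩ := exists_linearIsometryEquiv_of_inner_eq hef htotal
    (topologicalClosure_span_range_eq_top hf)
  refine ⟨Φ, fun g => DFunLike.congr_fun (linearIsometry_eq_of_total htotal
    (S := Φ.toLinearIsometry.comp (ρ g).toLinearIsometry)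
    (T := (ρ' g).toLinearIsometry.comp Φ.toLinearIsometry) fun i => ?_)⟩
  simp [hΦ, hρ, hρ']

/-! ### Identities for multilinear maps -/

section Multilinear

variable {ι E : Type*} [AddCommGroup E]

lemma map_add_smul_eq_zero_of_infinite [Finite ι] {R : Type*} [CommRing R] [IsDomain R]
    [Module R E]
    (M : MultilinearMap R (fun _ : ι => E) R) (x y : ι → E) {s : Set R} (hs : s.Infinite)
    (h : ∀ t ∈ s, M (x + t • y) = 0) (z : R) : M (x + z • y) = 0 := by
  classical
  cases nonempty_fintype ι
  let P : R[X] := ∑ A : Finset ι, C (M (Aᶜ.piecewise x y)) * X ^ A.card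
  have hP (t : R) : P.eval t = M (x + t • y) := by
    rw [add_comm, M.map_add_univ, eval_finsetSum]
    refine Finset.sum_congr rfl fun A _ => ?_
    have hA : A.piecewise (t • y) x = A.piecewise (t • Aᶜ.piecewise x y) (Aᶜ.piecewise x y) := by
      ext i; by_cases hi : i ∈ A <;> simp [hi]
    have := M.map_piecewise_smul (fun _ => t) (Aᶜ.piecewise x y) A
    simp only [Finset.prod_const] at this
    rw [hA, eval_mul, eval_C, eval_pow, eval_X, mul_comm]
    exact this.symm
  have hP0 : P = 0 := eq_zero_of_infinite_isRoot P (hs.mono fun t ht => by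
    simpa [IsRoot, hP] using h t ht)
  rw [← hP, hP0, eval_zero]

/-- Expand `M (∑ j, z j • x j, …, ∑ j, z j • x j)` as a polynomial in `z` and read off the
coefficient of `∏ j, z j`. -/
lemma sum_perm_eq_zero_of_diag_eq_zero {R : Type*} [CommRing R] [IsDomain R] [Infinite R]
    [Module R E] [Fintype ι] [DecidableEq ι] (M : MultilinearMap R (fun _ : ι => E) R)
    (h : ∀ v, M (fun _ => v) = 0) (x : ι → E) : ∑ σ : Equiv.Perm ι, M (x ∘ σ) = 0 := by
  let P : MvPolynomial ι R := ∑ r : ι → ι, MvPolynomial.C (M (x ∘ r)) * ∏ i, MvPolynomial.X (r i)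
  have hP : P = 0 := MvPolynomial.funext fun z => by
    have hz := h (∑ j, z j • x j)
    rw [M.map_sum] at hz
    simpa [P, M.map_smul_univ, mul_comm, Function.comp_def] using hz
  have hmonomial (r : ι → ι) : ∏ i, MvPolynomial.X (R := R) (r i) =
      MvPolynomial.monomial (∑ i, Finsupp.single (r i) 1) 1 :=
    (MvPolynomial.monomial_sum_one _ _).symm
  have hbij (r : ι → ι) : ∑ i, Finsupp.single (r i) 1 = ∑ i, Finsupp.single i 1 ↔
      Function.Bijective r := by
    refine ⟨fun hr => Finite.injective_iff_bijective.1
      (Finite.injective_iff_surjective.2 fun j => ?_), fun hr => ?_⟩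
    · have hj := DFunLike.congr_fun hr j
      by_contra! hne
      simp [Finsupp.finsetSum_apply, Finsupp.single_apply, hne] at hj
    · exact hr.sum_comp fun i => Finsupp.single i 1
  have hcoeff := congrArg (MvPolynomial.coeff (∑ i, Finsupp.single i 1)) hP
  simp only [P, hmonomial, MvPolynomial.coeff_sum, MvPolynomial.coeff_C_mul,
    MvPolynomial.coeff_monomial, hbij, mul_ite, mul_one, mul_zero,
    MvPolynomial.coeff_zero] at hcoeff
  rw [← hcoeff, ← Finset.sum_filter]
  refine Finset.sum_bij (fun σ _ => ⇑σ) (fun σ _ => by simp)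
    (fun σ _ τ _ hστ => DFunLike.coe_injective hστ) (fun r hr => ?_) fun _ _ => rfl
  exact ⟨Equiv.ofBijective r (Finset.mem_filter.1 hr).2, Finset.mem_univ _, rfl⟩

end Multilinear

/-! ### Branching families -/

section Branching

variable {H K : Type*} [NormedAddCommGroup H] [InnerProductSpace ℂ H]
  [NormedAddCommGroup K] [InnerProductSpace ℂ K]

/-- The abstract form of the defining relation of `XInf`: vectors indexed by the finite binary
sequences that are orthonormal on each level and satisfy `e s = (e (s0) + e (s1)) / √2`. -/
structure IsBranching (e : List Bool → H) : Prop where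
  split : ∀ s, e s = (Real.sqrt 2 : ℂ)⁻¹ • (e (s ++ [false]) + e (s ++ [true]))
  inner_of_length_eq : ∀ s t, s.length = t.length → ⟪e s, e t⟫_ℂ = if s = t then 1 else 0

namespace IsBranching

variable {e : List Bool → H} {f : List Bool → K}

lemma inner_eq (he : IsBranching e) (hf : IsBranching f) (s t : List Bool) :
    ⟪e s, e t⟫_ℂ = ⟪f s, f t⟫_ℂ := by
  have hle (d : ℕ) : ∀ s t : List Bool, t.length = s.length + d → ⟪e s, e t⟫_ℂ = ⟪f s, f t⟫_ℂ := by
    induction d with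
    | zero =>
      intro s t h
      rw [he.inner_of_length_eq s t h.symm, hf.inner_of_length_eq s t h.symm]
    | succ d ih =>
      intro s t h
      have hchild (b : Bool) := ih (s ++ [b]) t (by rw [h, List.length_append]; simp; ring)
      rw [he.split s, hf.split s, inner_smul_left, inner_smul_left, inner_add_left, inner_add_left,
        hchild, hchild]
  rcases le_total s.length t.length with h | h <;> obtain ⟨d, hd⟩ := Nat.exists_eq_add_of_le h
  · exact hle d s t hd
  · rw [← inner_conj_symm, hle d t s hd, inner_conj_symm]

lemma orthonormal (he : IsBranching e) (n : ℕ) :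
    Orthonormal ℂ fun t : Fin n → Bool => e (List.ofFn t) := by
  rw [orthonormal_iff_ite]
  intro s t
  rw [he.inner_of_length_eq _ _ (by simp)]
  simp only [List.ofFn_inj]

lemma mem_span_level {s : List Bool} {n : ℕ} (hs : s.length = n) :
    e s ∈ Submodule.span ℂ (Set.range fun t : Fin n → Bool => e (List.ofFn t)) := by
  subst hs
  exact Submodule.subset_span ⟨s.get, by simp⟩

lemma monotone_span_level (he : IsBranching e) :
    Monotone fun n => Submodule.span ℂ (Set.range fun t : Fin n → Bool => e (List.ofFn t)) := by
  refine monotone_nat_of_le_succ fun n => Submodule.span_le.2 (Set.range_subset_iff.2 fun t => ?_)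
  have hmem (b : Bool) : e (List.ofFn t ++ [b]) ∈
      Submodule.span ℂ (Set.range fun t : Fin (n + 1) → Bool => e (List.ofFn t)) :=
    mem_span_level (by simp)
  rw [he.split]
  exact Submodule.smul_mem _ _ (Submodule.add_mem _ (hmem _) (hmem _))

lemma exists_eq_sum_level (he : IsBranching e) {x : H} (hx : x ∈ Submodule.span ℂ (Set.range e)) :
    ∃ (n : ℕ) (c : (Fin n → Bool) → ℂ), x = ∑ t, c t • e (List.ofFn t) := by
  have hle : Submodule.span ℂ (Set.range e) ≤
      ⨆ n, Submodule.span ℂ (Set.range fun t : Fin n → Bool => e (List.ofFn t)) :=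
    Submodule.span_le.2 (Set.range_subset_iff.2 fun s =>
      Submodule.mem_iSup_of_mem s.length (mem_span_level rfl))
  obtain ⟨n, hn⟩ :=
    (Submodule.mem_iSup_of_directed _ he.monotone_span_level.directed_le).1 (hle hx)
  obtain ⟨c, hc⟩ := (Submodule.mem_span_range_iff_exists_fun ℂ).1 hn
  exact ⟨n, c, hc.symm⟩

end IsBranching

end Branching

/-! ### Cylinders in the Cantor space -/

lemma ae_eq_zero_of_setIntegral_piSystem {α E : Type*} [m : MeasurableSpace α] {μ : Measure α}
    [NormedAddCommGroup E] [NormedSpace ℝ E] [CompleteSpace E] {f : α → E} (hf : Integrable f μ)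
    {C : Set (Set α)} (hC : m = MeasurableSpace.generateFrom C) (hpi : IsPiSystem C)
    (huniv : Set.univ ∈ C) (h : ∀ S ∈ C, ∫ x in S, f x ∂μ = 0) : f =ᵐ[μ] 0 := by
  refine hf.ae_eq_zero_of_forall_setIntegral_eq_zero fun S hS _ => ?_
  clear * - hf hC hpi huniv h hS
  induction S, hS using MeasurableSpace.induction_on_inter hC hpi with
  | empty => simp
  | basic S hS => exact h S hS
  | compl S hS ih => rw [setIntegral_compl hS hf, ih, ← setIntegral_univ, h _ huniv, sub_zero]
  | iUnion S hd hS ih => rw [integral_iUnion hS hd hf.integrableOn]; simp_rw [ih, tsum_zero]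

/-- The cylinder `[s]` of the sequences extending `s`. -/
def cylinder (s : List Bool) : Set Cantor := {a | (List.range s.length).map a = s}

lemma cylinder_nil : cylinder [] = Set.univ := by simp [cylinder]

lemma mem_cylinder_append {s : List Bool} {b : Bool} {a : Cantor} :
    a ∈ cylinder (s ++ [b]) ↔ a ∈ cylinder s ∧ a s.length = b := by
  simp [cylinder, List.range_succ]

lemma cylinder_eq_pi (s : List Bool) :
    cylinder s = Set.pi (Finset.range s.length) fun i => {s.getD i false} := by
  induction s using List.reverseRecOn with
  | nil => simp [cylinder]
  | append_singleton s b ih =>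
    ext a
    rw [mem_cylinder_append, ih]
    simp only [Set.mem_pi, Finset.coe_range, Set.mem_Iio, List.length_append, Set.mem_singleton_iff,
      List.length_singleton, Nat.forall_lt_succ_right]
    rw [List.getD_append_right _ _ _ _ le_rfl]
    refine and_congr (forall₂_congr fun i hi => ?_) (by simp)
    rw [List.getD_append _ _ _ _ hi]

lemma measurableSet_cylinder (s : List Bool) : MeasurableSet (cylinder s) :=
  cylinder_eq_pi s ▸ MeasurableSet.pi (Finset.countable_toSet _) fun _ _ => .of_discrete

lemma lam_cylinder (s : List Bool) : lam (cylinder s) = 2⁻¹ ^ s.length := by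
  rw [cylinder_eq_pi, lam, Measure.infinitePi_pi _ fun _ _ => .of_discrete]
  simp

lemma cylinder_inter_of_length_eq {s t : List Bool} (h : s.length = t.length) :
    cylinder s ∩ cylinder t = if s = t then cylinder s else ∅ := by
  split_ifs with hst
  · rw [hst, Set.inter_self]
  · refine Set.eq_empty_of_forall_notMem fun a ⟨hs, ht⟩ => hst ?_
    rw [← hs, ← ht, h]

lemma cylinder_subset_of_length_le {s t : List Bool} (h : s.length ≤ t.length)
    (hst : (cylinder s ∩ cylinder t).Nonempty) : cylinder t ⊆ cylinder s := by
  obtain ⟨a, hs : _ = s, ht : _ = t⟩ := hst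
  intro b (hb : _ = t)
  have htake (c : Cantor) : (List.range s.length).map c =
      ((List.range t.length).map c).take s.length := by
    rw [← List.map_take, List.take_range, min_eq_left h]
  change _ = s
  rw [htake, hb, ← ht, ← htake, hs]

lemma isPiSystem_cylinder : IsPiSystem (Set.range cylinder) := by
  rintro _ ⟨s, rfl⟩ _ ⟨t, rfl⟩ hst
  rcases le_total s.length t.length with h | h
  · exact ⟨t, (Set.inter_eq_right.2 (cylinder_subset_of_length_le h hst)).symm⟩
  · rw [Set.inter_comm] at hst ⊢
    exact ⟨s, (Set.inter_eq_right.2 (cylinder_subset_of_length_le h hst)).symm⟩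

lemma generateFrom_cylinder :
    MeasurableSpace.generateFrom (Set.range cylinder) =
      (inferInstance : MeasurableSpace Cantor) := by
  refine le_antisymm (MeasurableSpace.generateFrom_le ?_) (iSup_le fun i => ?_)
  · rintro _ ⟨s, rfl⟩
    exact measurableSet_cylinder s
  · rintro _ ⟨B, -, rfl⟩
    have hB : (fun a : Cantor => a i) ⁻¹' B =
        ⋃ s ∈ {s : List Bool | s.length = i + 1 ∧ s.getD i false ∈ B}, cylinder s := by
      ext a
      simp only [Set.mem_preimage, Set.mem_ofPred_eq, Set.mem_iUnion, exists_prop]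
      refine ⟨fun ha => ⟨(List.range (i + 1)).map a, by simpa using ha, by simp [cylinder]⟩, ?_⟩
      rintro ⟨s, ⟨hs, hsB⟩, has⟩
      rw [cylinder_eq_pi] at has
      rwa [has i (by simp [hs])]
    rw [hB]
    exact MeasurableSet.biUnion (Set.to_countable _) fun s _ =>
      MeasurableSpace.measurableSet_generateFrom ⟨s, rfl⟩

/-- The normalized indicator `2 ^ (|s| / 2) 1_[s]`. -/
def cylL2 (s : List Bool) : Lp ℂ 2 lam :=
  indicatorConstLp 2 (measurableSet_cylinder s) (measure_ne_top _ _) ((Real.sqrt 2 : ℂ) ^ s.length)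

lemma coeFn_cylL2 (s : List Bool) :
    cylL2 s =ᵐ[lam] (cylinder s).indicator fun _ => (Real.sqrt 2 : ℂ) ^ s.length :=
  indicatorConstLp_coeFn

lemma isBranching_cylL2 : IsBranching cylL2 where
  split s := by
    refine Lp.ext ?_
    filter_upwards [coeFn_cylL2 s, coeFn_cylL2 (s ++ [false]), coeFn_cylL2 (s ++ [true]),
      Lp.coeFn_smul (Real.sqrt 2 : ℂ)⁻¹ (cylL2 (s ++ [false]) + cylL2 (s ++ [true])),
      Lp.coeFn_add (cylL2 (s ++ [false])) (cylL2 (s ++ [true]))] with a hs h0 h1 hsmul hadd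
    rw [hsmul, Pi.smul_apply, hadd, Pi.add_apply, hs, h0, h1]
    have hne := sqrt_two_ne
    by_cases ha : a ∈ cylinder s <;> cases hb : a s.length <;>
      simp [Set.indicator, mem_cylinder_append, ha, hb, pow_succ] <;> field_simp
  inner_of_length_eq s t h := by
    rw [cylL2, cylL2, L2.inner_indicatorConstLp_indicatorConstLp, cylinder_inter_of_length_eq h]
    split_ifs with hst
    · have hpow : ((Real.sqrt 2 : ℂ) ^ s.length) ^ 2 = 2 ^ s.length := by
        rw [← pow_mul, mul_comm, pow_mul, pow_two, sqrt_two_mul]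
      simp [← hst, Measure.real, lam_cylinder, abs_of_nonneg (Real.sqrt_nonneg 2), hpow]
    · simp

lemma cylL2_total :
    (Submodule.span ℂ (Set.range cylL2)).topologicalClosure = ⊤ := by
  refine topologicalClosure_span_range_eq_top fun v hv => Lp.ext ?_
  refine (ae_eq_zero_of_setIntegral_piSystem ((Lp.memLp v).integrable one_le_two)
    generateFrom_cylinder.symm isPiSystem_cylinder ⟨[], cylinder_nil⟩ ?_).trans
    (Lp.coeFn_zero ℂ 2 lam).symm
  rintro _ ⟨s, rfl⟩
  have hs := hv s
  rw [cylL2, L2.inner_indicatorConstLp_eq_inner_setIntegral] at hs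
  simpa using hs

lemma coeFn_step {n : ℕ} (c : (Fin n → Bool) → Circle) :
    step c =ᵐ[lam] fun a => c fun i => a i :=
  AEEqFun.coeFn_mk _ _

lemma circleMul_step_cylL2 {n : ℕ} (c : (Fin n → Bool) → Circle) {s : List Bool}
    (hs : n ≤ s.length) :
    circleMul (step c) (cylL2 s) = (c fun i => s.getD i false : ℂ) • cylL2 s := by
  refine Lp.ext ?_
  filter_upwards [coeFn_circleMul (step c) (cylL2 s), coeFn_cylL2 s, coeFn_step c,
    Lp.coeFn_smul (c fun i => s.getD i false : ℂ) (cylL2 s)] with a hmul has hstep hsmul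
  rw [hmul, hsmul, Pi.smul_apply, hstep, has, smul_eq_mul]
  by_cases ha : a ∈ cylinder s
  · have hc : (fun i : Fin n => a i) = fun i : Fin n => s.getD i false := by
      rw [cylinder_eq_pi] at ha
      exact funext fun i => ha i (by simp; omega)
    rw [hc]
  · simp [ha]

/-! ### Measure-determining families of functions -/

section MeasureDetermining

variable {X ι : Type*} [MeasurableSpace X] {μ : Measure X} {φ : ι → X → ℂ}

/-- The integrals of the functions of the family determine a finite measure. -/
def IsMeasureDetermining (φ : ι → X → ℂ) : Prop :=
  ∀ P Q : Measure X, IsFiniteMeasure P → IsFiniteMeasure Q →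
    (∀ i, ∫ x, φ i x ∂P = ∫ x, φ i x ∂Q) → P = Q

lemma IsMeasureDetermining.ae_eq_zero_of_real (hdet : IsMeasureDetermining φ)
    (hφ : ∀ i, Measurable (φ i)) (hbdd : ∀ i, ∃ C, ∀ x, ‖φ i x‖ ≤ C) {u : X → ℝ}
    (hu : Integrable u μ) (h : ∀ i, ∫ x, (u x : ℂ) * φ i x ∂μ = 0) : u =ᵐ[μ] 0 := by
  have hmeas {v : X → ℝ} (hv : Integrable v μ) : AEMeasurable (fun x => ENNReal.ofReal (v x)) μ :=
    hv.aestronglyMeasurable.aemeasurable.ennreal_ofReal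
  have hdensity {v : X → ℝ} (hv : Integrable v μ) (i : ι) :
      ∫ x, φ i x ∂μ.withDensity (fun x => ENNReal.ofReal (v x)) =
        ∫ x, ((max (v x) 0 : ℝ) : ℂ) * φ i x ∂μ := by
    rw [integral_withDensity_eq_integral_toReal_smul₀ (hmeas hv) (by simp)]
    simp [ENNReal.toReal_ofReal']
  have hint {v : X → ℝ} (hv : Integrable v μ) (i : ι) :
      Integrable (fun x => ((max (v x) 0 : ℝ) : ℂ) * φ i x) μ := by
    obtain ⟨C, hC⟩ := hbdd i
    exact hv.pos_part.ofReal.mul_bdd (hφ i).aestronglyMeasurable (ae_of_all _ hC)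
  have heq : μ.withDensity (fun x => ENNReal.ofReal (u x)) =
      μ.withDensity fun x => ENNReal.ofReal ((-u) x) := by
    refine hdet _ _ (isFiniteMeasure_withDensity_ofReal hu.2)
      (isFiniteMeasure_withDensity_ofReal hu.neg.2) fun i => ?_
    rw [hdensity hu, hdensity hu.neg, ← sub_eq_zero, ← integral_sub (hint hu i) (hint hu.neg i),
      ← h i]
    refine integral_congr_ae (ae_of_all _ fun x => ?_)
    simp only [Pi.neg_apply, ← sub_mul, ← Complex.ofReal_sub]
    rw [max_zero_sub_max_neg_zero_eq_self]
  rw [withDensity_eq_iff (hmeas hu) (hmeas hu.neg) hu.lintegral_lt_top.ne] at heq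
  filter_upwards [heq] with x hx
  rcases le_total (u x) 0 with h0 | h0
  · rw [ENNReal.ofReal_of_nonpos h0, eq_comm, ENNReal.ofReal_eq_zero, Pi.neg_apply] at hx
    exact le_antisymm h0 (by simpa using hx)
  · rw [Pi.neg_apply, ENNReal.ofReal_of_nonpos (neg_nonpos.2 h0), ENNReal.ofReal_eq_zero] at hx
    exact le_antisymm hx h0

lemma IsMeasureDetermining.ae_eq_zero (hdet : IsMeasureDetermining φ)
    (hφ : ∀ i, Measurable (φ i)) (hbdd : ∀ i, ∃ C, ∀ x, ‖φ i x‖ ≤ C)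
    (hstar : ∀ i, ∃ j, ∀ x, φ j x = conj (φ i x)) {v : X → ℂ} (hv : Integrable v μ)
    (h : ∀ i, ∫ x, v x * φ i x ∂μ = 0) : v =ᵐ[μ] 0 := by
  have hvstar : Integrable (fun x => conj (v x)) μ :=
    (LinearIsometryEquiv.integrable_comp_iff Complex.conjLIE).2 hv
  have hint {w : X → ℂ} (hw : Integrable w μ) (i : ι) : Integrable (fun x => w x * φ i x) μ := by
    obtain ⟨C, hC⟩ := hbdd i
    exact hw.mul_bdd (hφ i).aestronglyMeasurable (ae_of_all _ hC)
  have hconj (i : ι) : ∫ x, conj (v x) * φ i x ∂μ = 0 := by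
    obtain ⟨j, hj⟩ := hstar i
    rw [← map_zero conj, ← h j, ← integral_conj]
    simp [hj]
  have hre : (fun x => (v x).re) =ᵐ[μ] 0 := by
    refine hdet.ae_eq_zero_of_real hφ hbdd hv.re fun i => ?_
    simp_rw [Complex.re_eq_add_conj, div_mul_eq_mul_div, add_mul]
    rw [integral_div, integral_add (hint hv i) (hint hvstar i), h, hconj, add_zero, zero_div]
  have him : (fun x => (v x).im) =ᵐ[μ] 0 := by
    refine hdet.ae_eq_zero_of_real hφ hbdd hv.im fun i => ?_
    simp_rw [Complex.im_eq_sub_conj, div_mul_eq_mul_div, sub_mul]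
    rw [integral_div, integral_sub (hint hv i) (hint hvstar i), h, hconj, sub_zero, zero_div]
  filter_upwards [hre, him] with x hxre hxim
  exact Complex.ext hxre hxim

end MeasureDetermining

/-! ### Weyl functions -/

section Weyl

/-- The character `z ↦ exp (i (z + z̄))` of the complex plane. -/
def weyl (z : ℂ) : ℂ := Circle.exp (2 * z.re)

lemma weyl_zero : weyl 0 = 1 := by simp [weyl]

lemma norm_weyl (z : ℂ) : ‖weyl z‖ = 1 := Circle.norm_coe _

lemma continuous_weyl : Continuous weyl := by unfold weyl; fun_prop

lemma weyl_add (z w : ℂ) : weyl (z + w) = weyl z * weyl w := by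
  simp [weyl, mul_add]

lemma weyl_sum {ι : Type*} (s : Finset ι) (z : ι → ℂ) :
    weyl (∑ i ∈ s, z i) = ∏ i ∈ s, weyl (z i) := by
  classical
  induction s using Finset.induction_on with
  | empty => simp [weyl_zero]
  | insert i s hi ih => rw [Finset.sum_insert hi, Finset.prod_insert hi, weyl_add, ih]

lemma conj_weyl (z : ℂ) : conj (weyl z) = weyl (-z) := by
  rw [weyl, weyl, ← Circle.coe_inv_eq_conj, ← Circle.exp_neg]; simp

lemma norm_weyl_sub_le (z w : ℂ) : ‖weyl z - weyl w‖ ≤ 2 * ‖z - w‖ := by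
  have hfactor : weyl z - weyl w = weyl w * (weyl (z - w) - 1) := by
    rw [mul_sub, ← weyl_add, mul_one, add_sub_cancel]
  calc ‖weyl z - weyl w‖ = ‖weyl (z - w) - 1‖ := by rw [hfactor, norm_mul, norm_weyl, one_mul]
    _ ≤ |2 * (z - w).re| := by
      rw [weyl, Circle.coe_exp, mul_comm]
      exact Real.norm_exp_I_mul_ofReal_sub_one_le
    _ ≤ 2 * ‖z - w‖ := by
      rw [abs_mul, abs_two]
      gcongr
      exact Complex.abs_re_le_norm _

lemma isMeasureDetermining_weyl {ι : Type*} [Countable ι] :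
    IsMeasureDetermining fun (w : ι →₀ ℂ) (z : ι → ℂ) =>
      weyl (Finsupp.linearCombination ℂ z w) := by
  intro P Q _ _ h
  let _ := TopologicalSpace.upgradeIsCompletelyMetrizable (ι → ℂ)
  let _ : TopologicalSpace (ι →₀ ℂ) := ⊥
  have _ : DiscreteTopology (ι →₀ ℂ) := ⟨rfl⟩
  let L : (ι → ℂ) →ₗ[ℝ] (ι →₀ ℂ) →ₗ[ℝ] ℝ := LinearMap.mk₂ ℝ
    (fun z w => 2 * (Finsupp.linearCombination ℂ z w).re)
    (fun z z' w => by simp [Finsupp.linearCombination_apply, Finsupp.sum_add, mul_add])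
    (fun r z w => by
      have hsmul : Finsupp.linearCombination ℂ (r • z) w =
          r • Finsupp.linearCombination ℂ z w := by
        simp only [Finsupp.linearCombination_apply, Finsupp.smul_sum, Pi.smul_apply]
        exact Finsupp.sum_congr fun _ _ => smul_comm ..
      rw [hsmul, Complex.smul_re, smul_eq_mul, smul_eq_mul, mul_left_comm])
    (fun z w w' => by simp [mul_add])
    (fun r z w => by
      have hsmul : r • w = (r : ℂ) • w := by ext; simp
      rw [hsmul, map_smul, smul_eq_mul, Complex.re_ofReal_mul, smul_eq_mul, mul_left_comm])
  have hL : Continuous fun p : (ι → ℂ) × (ι →₀ ℂ) => L p.1 p.2 := by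
    refine continuous_prod_of_discrete_right.2 fun w => ?_
    simp only [L, LinearMap.mk₂_apply, Finsupp.linearCombination_apply, Finsupp.sum]
    fun_prop
  refine ext_of_integral_char_eq Real.continuous_probChar Real.probChar_ne_one (L := L)
    (fun z hz hLz => hz (funext fun i => ?_)) hL h
  have hzi : 2 * (Finsupp.linearCombination ℂ z (Finsupp.single i (conj (z i)))).re = 0 :=
    LinearMap.congr_fun hLz (Finsupp.single i (conj (z i)))
  simpa [mul_comm _ (z i), Complex.mul_conj, Complex.normSq_eq_zero] using hzi

variable {X : Type*} [MeasurableSpace X] {μ : Measure X} [IsFiniteMeasure μ]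

lemma memLp_weyl (u : Lp ℂ 2 μ) : MemLp (fun x => weyl (u x)) 2 μ :=
  MemLp.of_bound (continuous_weyl.comp_aestronglyMeasurable (Lp.aestronglyMeasurable u)) 1
    (ae_of_all _ fun _ => (norm_weyl _).le)

/-- The class of `weyl ∘ u` in `L²`. -/
def weylL2 (u : Lp ℂ 2 μ) : Lp ℂ 2 μ := (memLp_weyl u).toLp

lemma coeFn_weylL2 (u : Lp ℂ 2 μ) : weylL2 u =ᵐ[μ] fun x => weyl (u x) :=
  (memLp_weyl u).coeFn_toLp

lemma continuous_weylL2 : Continuous (weylL2 : Lp ℂ 2 μ → Lp ℂ 2 μ) := by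
  refine (LipschitzWith.of_dist_le_mul (K := 2) fun u v => ?_).continuous
  rw [dist_eq_norm, dist_eq_norm]
  refine Lp.norm_le_mul_norm_of_ae_le_mul ?_
  filter_upwards [coeFn_weylL2 u, coeFn_weylL2 v, Lp.coeFn_sub u v,
    Lp.coeFn_sub (weylL2 u) (weylL2 v)] with x hu hv huv hsub
  rw [hsub, huv, Pi.sub_apply, Pi.sub_apply, hu, hv]
  exact norm_weyl_sub_le _ _

lemma inner_weylL2 (u v : Lp ℂ 2 μ) :
    ⟪weylL2 u, weylL2 v⟫_ℂ = ∫ x, weyl ((v - u) x) ∂μ := by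
  rw [L2.inner_def]
  refine integral_congr_ae ?_
  filter_upwards [coeFn_weylL2 u, coeFn_weylL2 v, Lp.coeFn_sub v u] with x hu hv hsub
  rw [hu, hv, hsub, RCLike.inner_apply, conj_weyl, ← weyl_add, Pi.sub_apply, sub_eq_add_neg]

end Weyl

/-! ### The isonormal process -/

section Isonormal

lemma IsMeasureDetermining.comap {X Y ι : Type*} [mX : MeasurableSpace X] [mY : MeasurableSpace Y]
    {φ : ι → X → ℂ} (hdet : IsMeasureDetermining φ) (hφ : ∀ i, Measurable (φ i)) {g : Y → X}
    (hg : mY = MeasurableSpace.comap g mX) : IsMeasureDetermining fun i y => φ i (g y) := by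
  intro P Q _ _ h
  have hmeas : Measurable g := hg ▸ comap_measurable g
  have hmap : P.map g = Q.map g := hdet _ _ inferInstance inferInstance fun i => by
    rw [integral_map hmeas.aemeasurable (hφ i).aestronglyMeasurable,
      integral_map hmeas.aemeasurable (hφ i).aestronglyMeasurable, h i]
  refine Measure.ext fun S hS => ?_
  obtain ⟨B, hB, rfl⟩ := MeasurableSpace.measurableSet_comap.1 (hg ▸ hS)
  rw [← Measure.map_apply hmeas hB, hmap, Measure.map_apply hmeas hB]

lemma coeFn_linearCombination {X ι : Type*} [MeasurableSpace X] {μ : Measure X}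
    (u : ι → Lp ℂ 2 μ) (w : ι →₀ ℂ) :
    ⇑(Finsupp.linearCombination ℂ u w) =ᵐ[μ]
      fun x => Finsupp.linearCombination ℂ (fun i => u i x) w := by
  induction w using Finsupp.induction_linear with
  | zero =>
    simp only [map_zero]
    exact Lp.coeFn_zero ℂ 2 μ
  | add w w' hw hw' =>
    rw [map_add]
    filter_upwards [hw, hw', Lp.coeFn_add (Finsupp.linearCombination ℂ u w)
      (Finsupp.linearCombination ℂ u w')] with x hx hx' hadd
    rw [hadd, Pi.add_apply, hx, hx', map_add]
  | single i c =>
    simp only [Finsupp.linearCombination_single]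
    exact Lp.coeFn_smul c (u i)

lemma integral_gam (F : ℂ → ℂ) :
    ∫ z, F z ∂gam =
      ∫ x : ℝ × ℝ, F ⟨x.1, x.2⟩ ∂(gaussianReal 0 (1 / 2)).prod (gaussianReal 0 (1 / 2)) :=
  Complex.equivRealProdCLM.symm.toHomeomorph.measurableEmbedding.integral_map F

lemma integral_weyl_mul_gam (c : ℂ) : ∫ z, weyl (c * z) ∂gam = Real.exp (-‖c‖ ^ 2) := by
  have hsplit (x : ℝ × ℝ) : weyl (c * ⟨x.1, x.2⟩) =
      Complex.exp ((2 * c.re : ℝ) * x.1 * Complex.I) *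
        Complex.exp ((-2 * c.im : ℝ) * x.2 * Complex.I) := by
    rw [weyl, Circle.coe_exp, ← Complex.exp_add]
    congr 1
    push_cast [Complex.mul_re]
    ring
  simp_rw [integral_gam, hsplit]
  rw [integral_prod_mul (fun x : ℝ => Complex.exp ((2 * c.re : ℝ) * x * Complex.I))
    fun y : ℝ => Complex.exp ((-2 * c.im : ℝ) * y * Complex.I), ← charFun_apply_real,
    ← charFun_apply_real, charFun_gaussianReal, charFun_gaussianReal, ← Complex.exp_add,
    Complex.sq_norm, Complex.normSq_apply, Complex.ofReal_exp]
  congr 1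
  push_cast
  ring

lemma integral_id_gam : ∫ z, z ∂gam = 0 := by
  have hint : Integrable (fun x : ℝ => (x : ℂ)) (gaussianReal 0 (1 / 2)) :=
    (IsGaussian.integrable_id (μ := gaussianReal 0 (1 / 2))).ofReal
  simp_rw [integral_gam, Complex.mk_eq_add_mul_I]
  rw [integral_add (hint.comp_fst _) ((hint.comp_snd _).mul_const _), integral_mul_const,
    integral_fun_fst (f := fun x : ℝ => (x : ℂ)), integral_fun_snd (f := fun x : ℝ => (x : ℂ)),
    integral_complex_ofReal]
  simp [integral_id_gaussianReal]

lemma integral_sq_gaussianReal (v : ℝ≥0) : ∫ x : ℝ, x ^ 2 ∂gaussianReal 0 v = v := by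
  have hvar := variance_id_gaussianReal (μ := 0) (v := v)
  rwa [variance_of_integral_eq_zero aemeasurable_id integral_id_gaussianReal] at hvar

lemma integral_conj_mul_self_gam : ∫ z, conj z * z ∂gam = 1 := by
  have hint : Integrable (fun x : ℝ => x ^ 2) (gaussianReal 0 (1 / 2)) :=
    (memLp_id_gaussianReal 2).integrable_sq
  have hsq (z : ℂ) : conj z * z = ((z.re ^ 2 + z.im ^ 2 : ℝ) : ℂ) := by
    rw [mul_comm, Complex.mul_conj, Complex.normSq_apply, sq, sq]
  simp_rw [integral_gam, hsq]
  rw [integral_complex_ofReal, integral_add (hint.comp_fst _) (hint.comp_snd _),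
    integral_fun_fst (f := fun x : ℝ => x ^ 2), integral_fun_snd (f := fun x : ℝ => x ^ 2),
    integral_sq_gaussianReal]
  norm_num

lemma integral_conj_mul_pi_gam {ι : Type*} [Fintype ι] [DecidableEq ι] (s t : ι) :
    ∫ z : ι → ℂ, conj (z s) * z t ∂(Measure.pi fun _ => gam) = if s = t then 1 else 0 := by
  split_ifs with hst
  · subst hst
    rw [← integral_conj_mul_self_gam]
    exact integral_comp_eval (μ := fun _ : ι => gam) (i := s) (f := fun z => conj z * z)
      (by fun_prop)
  · have hindep : IndepFun (fun z : ι → ℂ => conj (z s)) (fun z => z t)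
        (Measure.pi fun _ => gam) :=
      ((iIndepFun_pi (X := fun _ : ι => id) fun _ => aemeasurable_id).indepFun hst).comp
        (φ := conj) (ψ := id) (by fun_prop) measurable_id
    rw [hindep.integral_fun_mul_eq_mul_integral (Measurable.aestronglyMeasurable (by fun_prop))
        (Measurable.aestronglyMeasurable (by fun_prop)),
      integral_comp_eval (μ := fun _ : ι => gam) (i := t) (f := fun z => z) (by fun_prop),
      integral_id_gam, mul_zero]

lemma measurePreserving_restrictLevel (n : ℕ) :
    MeasurePreserving (restrictLevel n) gamInf (Measure.pi fun _ => gam) :=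
  ⟨measurable_restrictLevel n, map_restrictLevel_gamInf n⟩

lemma integral_comp_restrictLevel {n : ℕ} {F : ((Fin n → Bool) → ℂ) → ℂ} (hF : Measurable F) :
    ∫ f, F (restrictLevel n f) ∂gamInf = ∫ z, F z ∂(Measure.pi fun _ => gam) := by
  rw [← map_restrictLevel_gamInf, integral_map (measurable_restrictLevel n).aemeasurable
    hF.aestronglyMeasurable]

lemma memLp_coord (s : List Bool) : MemLp (fun f : XInf => f s) 2 gamInf := by
  have hlaw := (measurePreserving_eval (fun _ : Fin s.length → Bool => gam) s.get).comp
    (measurePreserving_restrictLevel s.length)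
  have hmem := (IsGaussian.memLp_id gam 2 (by simp)).comp_measurePreserving hlaw
  simpa [Function.comp_def, restrictLevel] using hmem

/-- The class of the coordinate `f ↦ f s` in `L²`. -/
def coordL2 (s : List Bool) : Lp ℂ 2 gamInf := (memLp_coord s).toLp

lemma coeFn_coordL2 (s : List Bool) : coordL2 s =ᵐ[gamInf] fun f => f s :=
  (memLp_coord s).coeFn_toLp

lemma isBranching_coordL2 : IsBranching coordL2 where
  split s := by
    refine Lp.ext ?_
    filter_upwards [coeFn_coordL2 s, coeFn_coordL2 (s ++ [false]), coeFn_coordL2 (s ++ [true]),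
      Lp.coeFn_smul (Real.sqrt 2 : ℂ)⁻¹ (coordL2 (s ++ [false]) + coordL2 (s ++ [true])),
      Lp.coeFn_add (coordL2 (s ++ [false])) (coordL2 (s ++ [true]))] with f hs h0 h1 hsmul hadd
    rw [hsmul, Pi.smul_apply, hadd, Pi.add_apply, hs, h0, h1, f.2 s, smul_eq_mul, inv_mul_eq_div]
  inner_of_length_eq s t h := by
    obtain ⟨n, s, rfl⟩ : ∃ (n : ℕ) (s' : Fin n → Bool), s = List.ofFn s' :=
      ⟨s.length, s.get, by simp⟩
    obtain ⟨t, rfl⟩ : ∃ t' : Fin n → Bool, t = List.ofFn t' := by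
      simp only [List.length_ofFn] at h
      subst h
      exact ⟨t.get, by simp⟩
    simp only [List.ofFn_inj]
    rw [← integral_conj_mul_pi_gam, ← integral_comp_restrictLevel (by fun_prop), L2.inner_def]
    refine integral_congr_ae ?_
    filter_upwards [coeFn_coordL2 (List.ofFn s), coeFn_coordL2 (List.ofFn t)] with f hs ht
    rw [hs, ht, RCLike.inner_apply', restrictLevel, restrictLevel]

lemma exists_isonormal : ∃ W : Lp ℂ 2 lam →ₗᵢ[ℂ] Lp ℂ 2 gamInf, ∀ s, W (cylL2 s) = coordL2 s :=
  exists_linearIsometry_of_inner_eq (isBranching_cylL2.inner_eq isBranching_coordL2) cylL2_total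

/-- The isonormal process: the isometric embedding of `L²(λ)` into `L²(γ_∞)` that sends the
normalized indicator of the cylinder `[s]` to the coordinate `f ↦ f s`. -/
def isonormal : Lp ℂ 2 lam →ₗᵢ[ℂ] Lp ℂ 2 gamInf := exists_isonormal.choose

lemma isonormal_cylL2 (s : List Bool) : isonormal (cylL2 s) = coordL2 s :=
  exists_isonormal.choose_spec s

lemma coeFn_isonormal_linearCombination (w : List Bool →₀ ℂ) :
    isonormal (Finsupp.linearCombination ℂ cylL2 w) =ᵐ[gamInf]
      fun f => Finsupp.linearCombination ℂ (f : List Bool → ℂ) w := by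
  have hcoord : isonormal (Finsupp.linearCombination ℂ cylL2 w) =
      Finsupp.linearCombination ℂ coordL2 w := by
    rw [← LinearIsometry.coe_toLinearMap, Finsupp.apply_linearCombination]
    exact congrArg (Finsupp.linearCombination ℂ · w) (funext isonormal_cylL2)
  rw [hcoord]
  filter_upwards [coeFn_linearCombination coordL2 w, ae_all_iff.2 coeFn_coordL2] with f hf hs
  rw [hf]
  simp only [hs]

lemma integral_weyl_isonormal_of_mem_span {x : Lp ℂ 2 lam}
    (hx : x ∈ Submodule.span ℂ (Set.range cylL2)) :
    ∫ f, weyl (isonormal x f) ∂gamInf = Real.exp (-‖x‖ ^ 2) := by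
  obtain ⟨n, c, rfl⟩ := isBranching_cylL2.exists_eq_sum_level hx
  have hsum : isonormal (∑ t, c t • cylL2 (List.ofFn t)) =ᵐ[gamInf]
      fun f => ∑ t, c t * restrictLevel n f t := by
    simp only [map_sum, map_smul, isonormal_cylL2]
    have hcomb := coeFn_linearCombination (fun t : Fin n → Bool => coordL2 (List.ofFn t))
      ((Finsupp.linearEquivFunOnFinite ℂ ℂ _).symm c)
    simp only [Finsupp.linearCombination_eq_fintype_linearCombination_apply,
      Fintype.linearCombination_apply, smul_eq_mul] at hcomb
    filter_upwards [hcomb, ae_all_iff.2 coeFn_coordL2] with f hf hcoord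
    simpa only [hcoord, restrictLevel] using hf
  calc ∫ f, weyl (isonormal (∑ t, c t • cylL2 (List.ofFn t)) f) ∂gamInf
      = ∫ f, ∏ t, weyl (c t * restrictLevel n f t) ∂gamInf :=
        integral_congr_ae (hsum.mono fun f hf => by simp only [hf, weyl_sum])
    _ = ∏ t, (Real.exp (-‖c t‖ ^ 2) : ℂ) := by
        rw [integral_comp_restrictLevel
            (F := fun z : (Fin n → Bool) → ℂ => ∏ t, weyl (c t * z t))
            (Continuous.measurable (by have := continuous_weyl; fun_prop)),
          integral_fintype_prod_eq_prod fun t z => weyl (c t * z)]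
        simp only [integral_weyl_mul_gam]
    _ = Real.exp (-‖∑ t, c t • cylL2 (List.ofFn t)‖ ^ 2) := by
        have hnorm : ‖∑ t, c t • cylL2 (List.ofFn t)‖ ^ 2 = ∑ t, ‖c t‖ ^ 2 := by
          rw [← inner_self_eq_norm_sq (𝕜 := ℂ), (isBranching_cylL2.orthonormal n).inner_sum]
          simp [← Complex.ofReal_pow, mul_comm (conj _), Complex.mul_conj']
        rw [hnorm, ← Complex.ofReal_prod, ← Real.exp_sum, Finset.sum_neg_distrib]

lemma integral_weyl_isonormal (x : Lp ℂ 2 lam) :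
    ∫ f, weyl (isonormal x f) ∂gamInf = Real.exp (-‖x‖ ^ 2) := by
  have hinner (y : Lp ℂ 2 lam) :
      ⟪weylL2 (0 : Lp ℂ 2 gamInf), weylL2 (isonormal y)⟫_ℂ = ∫ f, weyl (isonormal y f) ∂gamInf := by
    rw [inner_weylL2, sub_zero]
  have hclosed : IsClosed {y : Lp ℂ 2 lam |
      ⟪weylL2 (0 : Lp ℂ 2 gamInf), weylL2 (isonormal y)⟫_ℂ = Real.exp (-‖y‖ ^ 2)} :=
    isClosed_eq (continuous_const.inner (continuous_weylL2.comp isonormal.continuous))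
      (by fun_prop)
  have hmem : x ∈ (Submodule.span ℂ (Set.range cylL2)).topologicalClosure := by
    rw [cylL2_total]; trivial
  rw [← hinner]
  exact closure_minimal (fun y hy => (hinner y).trans (integral_weyl_isonormal_of_mem_span hy))
    hclosed hmem

lemma measurable_weyl_linearCombination {ι : Type*} (w : ι →₀ ℂ) :
    Measurable fun z : ι → ℂ => weyl (Finsupp.linearCombination ℂ z w) := by
  simp only [Finsupp.linearCombination_apply, Finsupp.sum]
  exact continuous_weyl.measurable.comp (by fun_prop)

lemma isMeasureDetermining_weyl_XInf : IsMeasureDetermining fun (w : List Bool →₀ ℂ) (f : XInf) =>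
    weyl (Finsupp.linearCombination ℂ (f : List Bool → ℂ) w) :=
  isMeasureDetermining_weyl.comap measurable_weyl_linearCombination rfl

lemma weylL2_isonormal_total {v : Lp ℂ 2 gamInf}
    (h : ∀ x, ⟪weylL2 (isonormal x), v⟫_ℂ = 0) : v = 0 := by
  refine Lp.ext ((isMeasureDetermining_weyl_XInf.ae_eq_zero
    (fun w => (measurable_weyl_linearCombination w).comp measurable_subtype_coe)
    (fun w => ⟨1, fun f => (norm_weyl _).le⟩) (fun w => ⟨-w, fun f => ?_⟩)
    ((Lp.memLp v).integrable one_le_two) fun w => ?_).trans (Lp.coeFn_zero ℂ 2 gamInf).symm)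
  · rw [conj_weyl, map_neg]
  · rw [← h (Finsupp.linearCombination ℂ cylL2 (-w)), L2.inner_def]
    refine integral_congr_ae ?_
    filter_upwards [coeFn_weylL2 (isonormal (Finsupp.linearCombination ℂ cylL2 (-w))),
      coeFn_isonormal_linearCombination (-w)] with f hweyl hf
    rw [hweyl, hf, RCLike.inner_apply, conj_weyl, map_neg, neg_neg]

end Isonormal

/-! ### Second quantization -/

section SecondQuantization

lemma XInf_eq_of_forall_le_length {n : ℕ} {f g : XInf} (h : ∀ s, n ≤ s.length → f s = g s) :
    f = g := by
  have hlevel (k : ℕ) : ∀ s, n ≤ s.length + k → f s = g s := by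
    induction k with
    | zero => exact h
    | succ k ih =>
      intro s hs
      rw [f.2 s, g.2 s, ih _ (by simp; omega), ih _ (by simp; omega)]
  exact Subtype.ext (funext fun s => hlevel n s (Nat.le_add_left n _))

/-- The root value and the increments of a function on finite binary sequences; on `XInf` this is
inverse to `branch`. -/
def increments (f : List Bool → ℂ) : Option (List Bool) → ℂ
  | none => f []
  | some s => (f (s ++ [true]) - f (s ++ [false])) / (Real.sqrt 2 : ℂ)

lemma branch_increments {f : List Bool → ℂ}
    (hf : ∀ s, f s = (f (s ++ [false]) + f (s ++ [true])) / (Real.sqrt 2 : ℂ)) (s : List Bool) :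
    branch (increments f) s = f s := by
  induction s using List.reverseRecOn with
  | nil => simp [branch, increments]
  | append_singleton s b ih =>
    rw [branch_append, ih, hf s, increments]
    cases b <;> field_simp [sqrt_two_ne] <;> rw [sq, sqrt_two_mul] <;>
      simp only [Bool.false_eq_true, if_false, if_true] <;> ring

lemma measurable_increments : Measurable increments :=
  measurable_pi_lambda _ fun o => by
    cases o with
    | none => exact measurable_pi_apply _
    | some s => exact Measurable.div_const (by fun_prop) _

/-- The transformation of `XInf` induced by an isometry `U` of `L²(λ)`: the coordinate at `s` of
the image of `f` is the value at `f` of the Gaussian variable of `U (cylL2 s)`. This prescription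
satisfies the relations of `XInf` only for almost all `f`, so the image is rebuilt from its
increments. -/
def gaussFun (U : Lp ℂ 2 lam →ₗᵢ[ℂ] Lp ℂ 2 lam) (f : XInf) : XInf :=
  branchX (increments fun s => isonormal (U (cylL2 s)) f)

variable (U : Lp ℂ 2 lam →ₗᵢ[ℂ] Lp ℂ 2 lam)

lemma measurable_gaussFun : Measurable (gaussFun U) :=
  measurable_branchX.comp (measurable_increments.comp
    (measurable_pi_lambda _ fun _ => (Lp.stronglyMeasurable _).measurable))

lemma gaussFun_ae_eq :
    ∀ᵐ f ∂gamInf, (gaussFun U f : List Bool → ℂ) = fun s => isonormal (U (cylL2 s)) f := by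
  have hsplit (s : List Bool) : ∀ᵐ f ∂gamInf, isonormal (U (cylL2 s)) f =
      (isonormal (U (cylL2 (s ++ [false]))) f + isonormal (U (cylL2 (s ++ [true]))) f) /
        (Real.sqrt 2 : ℂ) := by
    rw [isBranching_cylL2.split s]
    simp only [map_smul, map_add]
    filter_upwards [Lp.coeFn_smul (Real.sqrt 2 : ℂ)⁻¹ (isonormal (U (cylL2 (s ++ [false]))) +
        isonormal (U (cylL2 (s ++ [true])))),
      Lp.coeFn_add (isonormal (U (cylL2 (s ++ [false])))) (isonormal (U (cylL2 (s ++ [true]))))]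
      with f hsmul hadd
    rw [hsmul, Pi.smul_apply, hadd, Pi.add_apply, smul_eq_mul, inv_mul_eq_div]
  filter_upwards [ae_all_iff.2 hsplit] with f hf
  exact funext (branch_increments hf)

lemma coeFn_isonormal_comp_linearCombination (w : List Bool →₀ ℂ) :
    isonormal (U (Finsupp.linearCombination ℂ cylL2 w)) =ᵐ[gamInf]
      fun f => Finsupp.linearCombination ℂ (gaussFun U f : List Bool → ℂ) w := by
  have hmap : isonormal (U (Finsupp.linearCombination ℂ cylL2 w)) =
      Finsupp.linearCombination ℂ (fun s => isonormal (U (cylL2 s))) w :=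
    Finsupp.apply_linearCombination ℂ (isonormal.comp U).toLinearMap cylL2 w
  rw [hmap]
  filter_upwards [coeFn_linearCombination (fun s => isonormal (U (cylL2 s))) w, gaussFun_ae_eq U]
    with f hf hU
  rw [hf, hU]

lemma measurePreserving_gaussFun : MeasurePreserving (gaussFun U) gamInf gamInf := by
  have hmeas := measurable_gaussFun U
  refine ⟨hmeas, isMeasureDetermining_weyl_XInf _ _ inferInstance inferInstance fun w => ?_⟩
  have hweyl := (measurable_weyl_linearCombination w).comp
    (measurable_subtype_coe : Measurable ((↑) : XInf → List Bool → ℂ))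
  set x := Finsupp.linearCombination ℂ cylL2 w
  calc ∫ f, weyl (Finsupp.linearCombination ℂ (f : List Bool → ℂ) w) ∂gamInf.map (gaussFun U)
      = ∫ f, weyl (Finsupp.linearCombination ℂ (gaussFun U f : List Bool → ℂ) w) ∂gamInf :=
        integral_map hmeas.aemeasurable hweyl.aestronglyMeasurable
    _ = ∫ f, weyl (isonormal (U x) f) ∂gamInf :=
        integral_congr_ae ((coeFn_isonormal_comp_linearCombination U w).mono fun f hf => by
          simp only [x, hf])
    _ = ∫ f, weyl (isonormal x f) ∂gamInf := by
        rw [integral_weyl_isonormal, integral_weyl_isonormal, U.norm_map]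
    _ = ∫ f, weyl (Finsupp.linearCombination ℂ (f : List Bool → ℂ) w) ∂gamInf :=
        integral_congr_ae ((coeFn_isonormal_linearCombination w).mono fun f hf => by
          simp only [x, hf])

/-- The class of `gaussFun U` modulo equality almost everywhere. -/
def gaussMap : MPMap gamInf :=
  ⟨AEEqFun.mk (gaussFun U) (measurable_gaussFun U).aestronglyMeasurable,
    (measurePreserving_gaussFun U).congr (AEEqFun.stronglyMeasurable _).measurable
      (AEEqFun.coeFn_mk _ _).symm⟩

lemma coeFn_gaussMap : gaussMap U =ᵐ[gamInf] gaussFun U := AEEqFun.coeFn_mk _ _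

lemma gaussMap_ae_eq :
    ∀ᵐ f ∂gamInf, (gaussMap U f : List Bool → ℂ) = fun s => isonormal (U (cylL2 s)) f := by
  filter_upwards [coeFn_gaussMap U, gaussFun_ae_eq U] with f hf hU
  rw [hf, hU]

lemma gaussMap_eq_of_ae {T : MPMap gamInf}
    (h : ∀ s, (fun f => T f s) =ᵐ[gamInf] isonormal (U (cylL2 s))) : gaussMap U = T := by
  refine MPMap.ext ?_
  filter_upwards [gaussMap_ae_eq U, ae_all_iff.2 h] with f hU hT
  exact Subtype.ext (hU.trans (funext fun s => (hT s).symm))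

lemma compMeasurePreserving_isonormal (x : Lp ℂ 2 lam) :
    Lp.compMeasurePreserving (gaussMap U) (gaussMap U).2 (isonormal x) = isonormal (U x) := by
  have heq : (Lp.compMeasurePreservingₗᵢ ℂ (gaussMap U) (gaussMap U).2).comp isonormal =
      isonormal.comp U := by
    refine linearIsometry_eq_of_total cylL2_total fun s => Lp.ext ?_
    have hcoord := (gaussMap U).2.quasiMeasurePreserving.ae_eq_comp (coeFn_coordL2 s)
    filter_upwards [Lp.coeFn_compMeasurePreserving (coordL2 s) (gaussMap U).2, hcoord,
      gaussMap_ae_eq U] with f hcomp hs hU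
    change Lp.compMeasurePreserving (gaussMap U) (gaussMap U).2 (isonormal (cylL2 s)) f = _
    rw [isonormal_cylL2, hcomp, hs, Function.comp_apply, hU]
    rfl
  exact congrArg (fun S : Lp ℂ 2 lam →ₗᵢ[ℂ] Lp ℂ 2 gamInf => S x) heq

lemma gaussMap_one : gaussMap 1 = 1 :=
  gaussMap_eq_of_ae 1 fun s => by
    rw [LinearIsometry.coe_one, id, isonormal_cylL2]
    filter_upwards [coeFn_coordL2 s, MPMap.coe_one gamInf] with f hs hone
    rw [hs, hone, id]

lemma gaussMap_mul (V : Lp ℂ 2 lam →ₗᵢ[ℂ] Lp ℂ 2 lam) :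
    gaussMap (V * U) = gaussMap U * gaussMap V :=
  gaussMap_eq_of_ae (V * U) fun s => by
    rw [LinearIsometry.coe_mul, Function.comp_apply, ← compMeasurePreserving_isonormal]
    filter_upwards [Lp.coeFn_compMeasurePreserving (isonormal (U (cylL2 s))) (gaussMap V).2,
      (gaussMap V).2.quasiMeasurePreserving.ae (gaussMap_ae_eq U),
      MPMap.coe_mul (gaussMap U) (gaussMap V)] with f hcomp hU hmul
    rw [hcomp, hmul, Function.comp_apply, Function.comp_apply, hU]

lemma compMeasurePreserving_weylL2 {X : Type*} [MeasurableSpace X] {μ : Measure X}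
    [IsFiniteMeasure μ] {T : X → X} (hT : MeasurePreserving T μ μ) (u : Lp ℂ 2 μ) :
    Lp.compMeasurePreserving T hT (weylL2 u) = weylL2 (Lp.compMeasurePreserving T hT u) := by
  refine Lp.ext ?_
  filter_upwards [Lp.coeFn_compMeasurePreserving (weylL2 u) hT,
    hT.quasiMeasurePreserving.ae_eq_comp (coeFn_weylL2 u),
    coeFn_weylL2 (Lp.compMeasurePreserving T hT u), Lp.coeFn_compMeasurePreserving u hT]
    with x hcomp hu hweyl huT
  rw [hcomp, hu, hweyl, huT, Function.comp_apply, Function.comp_apply]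

lemma compMeasurePreserving_weylL2_isonormal (x : Lp ℂ 2 lam) :
    Lp.compMeasurePreserving (gaussMap U) (gaussMap U).2 (weylL2 (isonormal x)) =
      weylL2 (isonormal (U x)) := by
  rw [compMeasurePreserving_weylL2, compMeasurePreserving_isonormal]

end SecondQuantization

/-! ### Convergence in measure -/

section ConvergenceInMeasure

lemma norm_sq_eq_integral {X : Type*} [MeasurableSpace X] {μ : Measure X} (v : Lp ℂ 2 μ) :
    ‖v‖ ^ 2 = ∫ x, ‖v x‖ ^ 2 ∂μ := by
  have hinner : ((‖v‖ ^ 2 : ℝ) : ℂ) = ⟪v, v⟫_ℂ := by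
    rw [inner_self_eq_norm_sq_to_K]; simp
  rw [← Complex.ofReal_inj, hinner, L2.inner_def, ← integral_complex_ofReal]
  refine integral_congr_ae (ae_of_all _ fun x => ?_)
  simp [inner_self_eq_norm_sq_to_K]

lemma mul_measureReal_le_norm_sq {X : Type*} [MeasurableSpace X] {μ : Measure X} (v : Lp ℂ 2 μ)
    (r : ℝ) : r * μ.real {x | r ≤ ‖v x‖ ^ 2} ≤ ‖v‖ ^ 2 := by
  rw [norm_sq_eq_integral]
  exact mul_meas_ge_le_integral_of_nonneg (ae_of_all _ fun _ => by positivity)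
    ((memLp_two_iff_integrable_sq_norm (Lp.aestronglyMeasurable _)).1 (Lp.memLp _)) _

lemma norm_cylinder_indicator_sq_le (s : List Bool) (a : Cantor) :
    ‖(cylinder s).indicator (fun _ => (Real.sqrt 2 : ℂ) ^ s.length) a‖ ^ 2 ≤ 2 ^ s.length := by
  by_cases ha : a ∈ cylinder s
  · rw [Set.indicator_of_mem ha, norm_pow, Complex.norm_real, Real.norm_of_nonneg (by positivity),
      ← pow_mul, mul_comm, pow_mul, Real.sq_sqrt zero_le_two]
  · rw [Set.indicator_of_notMem ha]
    simp

lemma norm_circleMul_sub_circleMul_cylL2_sq_le (g h : L0) (s : List Bool) (ε : ℝ) :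
    ‖circleMul h (cylL2 s) - circleMul g (cylL2 s)‖ ^ 2 ≤
      2 ^ s.length * (ε ^ 2 + 4 * lam.real {a | ε ≤ dist (h a) (g a)}) := by
  set S := {a | ε ≤ dist (h a) (g a)}
  have hS : MeasurableSet S :=
    measurableSet_le measurable_const
    (continuous_dist.comp_stronglyMeasurable
      (h.stronglyMeasurable.prodMk g.stronglyMeasurable)).measurable
  have hint : Integrable (S.indicator fun _ => (4 : ℝ)) lam :=
    (integrable_const 4).indicator hS
  have hdist (a : Cantor) : ‖(h a : ℂ) - g a‖ ^ 2 ≤ ε ^ 2 + S.indicator (fun _ => 4) a := by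
    by_cases ha : a ∈ S
    · have h2 : ‖(h a : ℂ) - g a‖ ≤ 2 :=
        (norm_sub_le _ _).trans (by rw [Circle.norm_coe, Circle.norm_coe]; norm_num)
      rw [Set.indicator_of_mem ha]
      nlinarith [norm_nonneg ((h a : ℂ) - g a)]
    · rw [Set.indicator_of_notMem ha, add_zero]
      have hlt : ‖(h a : ℂ) - g a‖ < ε := by
        rw [← dist_eq_norm]; exact not_le.1 ha
      gcongr
  calc ‖circleMul h (cylL2 s) - circleMul g (cylL2 s)‖ ^ 2
      ≤ ∫ a, 2 ^ s.length * (ε ^ 2 + S.indicator (fun _ => 4) a) ∂lam := by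
        rw [norm_sq_eq_integral]
        refine integral_mono_of_nonneg (ae_of_all _ fun _ => by positivity)
          (((integrable_const _).add hint).const_mul _) ?_
        filter_upwards [Lp.coeFn_sub (circleMul h (cylL2 s)) (circleMul g (cylL2 s)),
          coeFn_circleMul h (cylL2 s), coeFn_circleMul g (cylL2 s), coeFn_cylL2 s]
          with a hsub hh hg has
        rw [hsub, Pi.sub_apply, hh, hg, ← sub_mul, has, norm_mul, mul_pow, mul_comm]
        exact mul_le_mul (norm_cylinder_indicator_sq_le s a)
          (hdist a) (by positivity) (by positivity)
    _ = 2 ^ s.length * (ε ^ 2 + 4 * lam.real S) := by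
        rw [integral_const_mul, integral_add (integrable_const _) hint,
          integral_indicator_const _ hS]
        simp [mul_comm]

lemma continuous_circleMul_apply (x : Lp ℂ 2 lam) : Continuous fun g : L0 => circleMul g x := by
  refine continuous_linearIsometry_apply_of_total cylL2_total (fun s => ?_) x
  refine continuous_def.2 fun V hV g hg => ?_
  obtain ⟨δ, hδ, hball⟩ := Metric.isOpen_iff.1 hV _ hg
  have hlim : Tendsto (fun ε : ℝ => 2 ^ s.length * (ε ^ 2 + 4 * ε)) (𝓝[>] 0) (𝓝 0) :=
    (Continuous.tendsto' (by fun_prop) 0 0 (by simp)).mono_left nhdsWithin_le_nhds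
  obtain ⟨ε, hεδ, hε : 0 < ε⟩ :=
    ((hlim.eventually_lt_const (pow_pos hδ 2)).and self_mem_nhdsWithin).exists
  refine ⟨ε, hε, fun h hh => hball ?_⟩
  have hreal : lam.real {a | ε ≤ dist (h a) (g a)} ≤ ε :=
    ENNReal.toReal_le_of_le_ofReal hε.le hh.le
  rw [Metric.mem_ball, dist_eq_norm]
  refine lt_of_pow_lt_pow_left₀ 2 hδ.le (lt_of_le_of_lt ?_ hεδ)
  exact (norm_circleMul_sub_circleMul_cylL2_sq_le g h s ε).trans (by gcongr)

lemma norm_exp_arg_sub_le (z : ℂ) (w : Circle) : ‖(Circle.exp z.arg : ℂ) - w‖ ≤ 2 * ‖z - w‖ := by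
  have hz : z = ‖z‖ * (Circle.exp z.arg : ℂ) := by
    rw [Circle.coe_exp, Complex.norm_mul_exp_arg_mul_I]
  have hproj : ‖(Circle.exp z.arg : ℂ) - z‖ ≤ ‖z - w‖ :=
    calc ‖(Circle.exp z.arg : ℂ) - z‖ = ‖((1 - ‖z‖ : ℝ) : ℂ) * (Circle.exp z.arg : ℂ)‖ := by
          congr 1
          conv_lhs => rw [hz]
          simp [sub_mul]
      _ = |‖(w : ℂ)‖ - ‖z‖| := by
          rw [norm_mul, Circle.norm_coe, Circle.norm_coe, mul_one, Complex.norm_real,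
            Real.norm_eq_abs]
      _ ≤ ‖z - w‖ := by rw [norm_sub_rev]; exact abs_norm_sub_norm_le _ _
  calc ‖(Circle.exp z.arg : ℂ) - w‖ ≤ ‖(Circle.exp z.arg : ℂ) - z‖ + ‖z - w‖ :=
        norm_sub_le_norm_sub_add_norm_sub _ _ _
    _ ≤ 2 * ‖z - w‖ := by linarith

lemma sum_cylL2_ae_eq {n : ℕ} (c : (Fin n → Bool) → ℂ) :
    ⇑(∑ t, c t • cylL2 (List.ofFn t)) =ᵐ[lam]
      fun a => c (fun i => a i) * (Real.sqrt 2 : ℂ) ^ n := by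
  have hall : ∀ᵐ a ∂lam, ∀ t : Fin n → Bool, cylL2 (List.ofFn t) a =
      (cylinder (List.ofFn t)).indicator (fun _ => (Real.sqrt 2 : ℂ) ^ n) a :=
    ae_all_iff.2 fun t => by
      filter_upwards [coeFn_cylL2 (List.ofFn t)] with a ha
      rw [ha, List.length_ofFn]
  have hsmul : ∀ᵐ a ∂lam, ∀ t : Fin n → Bool,
      (c t • cylL2 (List.ofFn t)) a = c t * cylL2 (List.ofFn t) a :=
    ae_all_iff.2 fun t => Lp.coeFn_smul _ _
  filter_upwards [Lp.coeFn_finsetSum Finset.univ fun t => c t • cylL2 (List.ofFn t), hall, hsmul]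
    with a hsum hcyl hs
  have hmem (t : Fin n → Bool) : a ∈ cylinder (List.ofFn t) ↔ t = fun i : Fin n => a i := by
    rw [cylinder, Set.mem_ofPred_eq, List.length_ofFn, ← List.map_coe_finRange_eq_range,
      List.map_map, ← List.ofFn_eq_map, List.ofFn_inj, eq_comm]
    rfl
  rw [hsum, Finset.sum_apply, Finset.sum_eq_single fun i : Fin n => a i]
  · rw [hs, hcyl, Set.indicator_of_mem ((hmem _).2 rfl)]
  · intro t _ ht
    rw [hs, hcyl, Set.indicator_of_notMem (mt (hmem t).1 ht), mul_zero]
  · simp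

lemma dense_range_step :
    Dense {g : L0 | ∃ (n : ℕ) (c : (Fin n → Bool) → Circle), g = step c} := by
  intro g
  refine mem_closure_iff.2 fun V hV hg => ?_
  obtain ⟨ε, hε, hεV⟩ := hV g hg
  set x := circleMul g (cylL2 [])
  have hx : x =ᵐ[lam] fun a => (g a : ℂ) := by
    filter_upwards [coeFn_circleMul g (cylL2 []), coeFn_cylL2 []] with a hmul hnil
    rw [hmul, hnil]
    simp [cylinder_nil]
  have hdense := Submodule.dense_iff_topologicalClosure_eq_top.2 cylL2_total
  obtain ⟨y, hy, hxy⟩ := hdense.exists_dist_lt x (ε := √ε * (ε / 2)) (by positivity)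
  obtain ⟨n, c, rfl⟩ := isBranching_cylL2.exists_eq_sum_level hy
  set y := ∑ t, c t • cylL2 (List.ofFn t)
  let u : L0 := step fun t => Circle.exp (c t * (Real.sqrt 2 : ℂ) ^ n).arg
  refine ⟨u, hεV u ?_, n, _, rfl⟩
  have hsub : lam {a | ε ≤ dist (u a) (g a)} ≤ lam {a | (ε / 2) ^ 2 ≤ ‖(y - x) a‖ ^ 2} := by
    refine measure_mono_ae ?_
    filter_upwards [Lp.coeFn_sub y x, hx, sum_cylL2_ae_eq c, coeFn_step fun t =>
      Circle.exp (c t * (Real.sqrt 2 : ℂ) ^ n).arg] with a hyx hxa hya hua hle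
    replace hle : ε ≤ ‖(u a : ℂ) - g a‖ := hle.trans_eq (dist_eq_norm (u a : ℂ) (g a))
    rw [hua] at hle
    have := hle.trans (norm_exp_arg_sub_le _ _)
    change (ε / 2) ^ 2 ≤ ‖(y - x) a‖ ^ 2
    rw [hyx, Pi.sub_apply, hxa, hya]
    gcongr
    linarith
  have hlt : ‖y - x‖ ^ 2 < (ε / 2) ^ 2 * ε := by
    rw [← dist_eq_norm, dist_comm]
    calc dist x y ^ 2 < (√ε * (ε / 2)) ^ 2 := by gcongr
      _ = (ε / 2) ^ 2 * ε := by rw [mul_pow, Real.sq_sqrt hε.le, mul_comm]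
  refine hsub.trans_lt ((ENNReal.lt_ofReal_iff_toReal_lt (measure_ne_top _ _)).2 ?_)
  exact lt_of_mul_lt_mul_left ((mul_measureReal_le_norm_sq _ _).trans_lt hlt) (by positivity)

end ConvergenceInMeasure

/-! ### The Gaussian action -/

section GaussianAction

lemma circleMul_mul {Y : Type*} [MeasurableSpace Y] {μ : Measure Y} (u v : Y →ₘ[μ] Circle) :
    circleMul (u * v) = circleMul u * circleMul v :=
  LinearIsometry.ext fun f => congrArg (fun Φ : Lp ℂ 2 μ ≃ₗᵢ[ℂ] Lp ℂ 2 μ => Φ f)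
    (map_mul (mulRep μ) u v)

lemma circleMul_one {Y : Type*} [MeasurableSpace Y] {μ : Measure Y} :
    circleMul (1 : Y →ₘ[μ] Circle) = 1 :=
  LinearIsometry.ext fun f => congrArg (fun Φ : Lp ℂ 2 μ ≃ₗᵢ[ℂ] Lp ℂ 2 μ => Φ f)
    (map_one (mulRep μ))

/-- The action of `L⁰(λ, 𝕋)` on `XInf` by second quantization of the multiplication operators. -/
def gaussAction : L0 →* Aut gamInf :=
  MonoidHom.toHomUnits
    { toFun := fun g => gaussMap (circleMul g)
      map_one' := by rw [circleMul_one, gaussMap_one]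
      map_mul' := fun g h => by rw [mul_comm, circleMul_mul, gaussMap_mul] }

lemma coe_gaussAction (g : L0) : (gaussAction g : MPMap gamInf) = gaussMap (circleMul g) := rfl

lemma gaussAction_step_ae_eq {n : ℕ} (c : (Fin n → Bool) → Circle) :
    (gaussAction (step c) : MPMap gamInf) =ᵐ[gamInf] stepAct c := by
  rw [coe_gaussAction]
  have hcoord : ∀ᵐ f ∂gamInf, ∀ s : List Bool, n ≤ s.length →
      isonormal (circleMul (step c) (cylL2 s)) f = c (fun i => s.getD i false) * f s := by
    refine ae_all_iff.2 fun s => ?_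
    by_cases hs : n ≤ s.length
    · rw [circleMul_step_cylL2 c hs, map_smul, isonormal_cylL2]
      filter_upwards [Lp.coeFn_smul (c fun i => s.getD i false : ℂ) (coordL2 s), coeFn_coordL2 s]
        with f hsmul hf _
      rw [hsmul, Pi.smul_apply, hf, smul_eq_mul]
    · exact ae_of_all _ fun f hn => absurd hn hs
  filter_upwards [gaussMap_ae_eq (circleMul (step c)), hcoord] with f hf hc
  refine XInf_eq_of_forall_le_length (n := n) fun s hs => ?_
  exact (congrFun hf s).trans ((hc s hs).trans (if_pos hs).symm)

lemma continuous_compMeasurePreserving_gaussMap_circleMul (x : Lp ℂ 2 gamInf) :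
    Continuous fun g : L0 => Lp.compMeasurePreserving (gaussMap (circleMul g))
      (gaussMap (circleMul g)).2 x := by
  refine continuous_linearIsometry_apply_of_total
    (S := fun g : L0 => Lp.compMeasurePreservingₗᵢ ℂ (gaussMap (circleMul g))
      (gaussMap (circleMul g)).2)
    (topologicalClosure_span_range_eq_top fun v => weylL2_isonormal_total) (fun y => ?_) x
  change Continuous fun g : L0 => Lp.compMeasurePreserving (gaussMap (circleMul g))
      (gaussMap (circleMul g)).2 (weylL2 (isonormal y))
  simp_rw [compMeasurePreserving_weylL2_isonormal]
  exact continuous_weylL2.comp (isonormal.continuous.comp (continuous_circleMul_apply y))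

section WeakTopology

variable {X : Type*} [TopologicalSpace X] [MeasurableSpace X] {μ : Measure X}

lemma measure_preimage_symmDiff [IsFiniteMeasure μ] (T : MPMap μ) {A B : Set X}
    (hA : MeasurableSet A) (hB : MeasurableSet B) :
    μ ((T ⁻¹' A) ∆ B) = ENNReal.ofReal (dist
      (Lp.compMeasurePreserving T T.2 (indicatorConstLp 2 hA (measure_ne_top μ A) (1 : ℂ)))
      (indicatorConstLp 2 hB (measure_ne_top μ B) 1) ^ 2) := by
  rw [Lp.indicatorConstLp_compMeasurePreserving, dist_indicatorConstLp_eq_norm,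
    norm_indicatorConstLp two_ne_zero ENNReal.ofNat_ne_top, norm_one, one_mul,
    ENNReal.toReal_ofNat, ← Real.sqrt_eq_rpow, Real.sq_sqrt measureReal_nonneg, ofReal_measureReal]

variable [TopologicalSpace.MetrizableSpace X] [SecondCountableTopology X] [BorelSpace X]

lemma continuous_measure_symmDiff {A B : Set X} (hA : MeasurableSet A) (hB : MeasurableSet B) :
    Continuous fun T : Aut μ => μ (((T : MPMap μ) ⁻¹' A) ∆ B) :=
  continuous_iInf_dom (i := ⟨A, hA⟩) (continuous_iInf_dom (i := ⟨B, hB⟩) continuous_induced_dom)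

instance : T2Space (Aut μ) where
  t2 S T hST := by
    obtain ⟨A, hA, hne⟩ : ∃ A, MeasurableSet A ∧
        μ (((S : MPMap μ) ⁻¹' A) ∆ ((T : MPMap μ) ⁻¹' A)) ≠ 0 := by
      by_contra! h
      exact hST (Units.ext (MPMap.ext (EventuallyEq.of_forall_separating_preimage MeasurableSet
        fun A hA => measure_symmDiff_eq_zero_iff.1 (h A hA))))
    refine separated_by_continuous
      (continuous_measure_symmDiff hA ((T : MPMap μ).2.measurable hA)) ?_
    simpa only [symmDiff_self, Set.bot_eq_empty, measure_empty] using hne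

end WeakTopology

lemma continuous_gaussAction : Continuous gaussAction := by
  refine continuous_iInf_rng.2 fun A => continuous_iInf_rng.2 fun B => continuous_induced_rng.2 ?_
  simp_rw [Function.comp_def, measure_preimage_symmDiff _ A.2 B.2]
  exact ENNReal.continuous_ofReal.comp
    (((continuous_compMeasurePreserving_gaussMap_circleMul _).dist continuous_const).pow 2)

lemma isGaussianAction_gaussAction : IsGaussianAction gaussAction :=
  ⟨continuous_gaussAction, fun _ c => gaussAction_step_ae_eq c⟩

lemma IsGaussianAction.eq {Θ Θ' : L0 →* Aut gamInf} (h : IsGaussianAction Θ)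
    (h' : IsGaussianAction Θ') : Θ = Θ' := by
  refine DFunLike.coe_injective (h.1.ext_on dense_range_step h'.1 ?_)
  rintro _ ⟨n, c, rfl⟩
  exact Units.ext (MPMap.ext ((h.2 n c).trans (h'.2 n c).symm))

end GaussianAction

/-! ### Tensor products of functions -/

section Tensor

variable {p q : ℕ}

/-- The coordinates of a point of `CSpace p q`. -/
def proj : Fin p ⊕ Fin q → CSpace p q → Cantor :=
  Sum.elim (fun i x => x.1 i) fun j x => x.2 j

lemma measurePreserving_proj (k : Fin p ⊕ Fin q) : MeasurePreserving (proj k) (muPQ p q) lam := by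
  cases k with
  | inl i => exact mp_fst p q i
  | inr j => exact mp_snd p q j

lemma integrable_prod_proj {F : Fin p ⊕ Fin q → Cantor → ℂ} (hF : ∀ k, Integrable (F k) lam) :
    Integrable (fun x => ∏ k, F k (proj k x)) (muPQ p q) := by
  simp only [Fintype.prod_sum_type]
  exact (Integrable.fintype_prod fun i => hF (.inl i)).mul_prod
    (Integrable.fintype_prod fun j => hF (.inr j))

lemma integral_prod_proj (F : Fin p ⊕ Fin q → Cantor → ℂ) :
    ∫ x, ∏ k, F k (proj k x) ∂muPQ p q = ∏ k, ∫ a, F k a ∂lam := by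
  simp only [Fintype.prod_sum_type]
  rw [← integral_fintype_prod_eq_prod, ← integral_fintype_prod_eq_prod]
  exact integral_prod_mul (fun a : Fin p → Cantor => ∏ i, F (.inl i) (a i))
    fun b : Fin q → Cantor => ∏ j, F (.inr j) (b j)

lemma memLp_prod_proj (m : Fin p ⊕ Fin q → Lp ℂ 2 lam) :
    MemLp (fun x => ∏ k, m k (proj k x)) 2 (muPQ p q) := by
  refine (memLp_two_iff_integrable_sq_norm (Finset.aestronglyMeasurable_fun_prod _ fun k _ =>
    (Lp.aestronglyMeasurable (m k)).comp_measurePreserving (measurePreserving_proj k))).2 ?_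
  have hsq (k) : Integrable (fun a => (‖m k a‖ : ℂ) ^ 2) lam := by
    exact_mod_cast ((memLp_two_iff_integrable_sq_norm (Lp.aestronglyMeasurable _)).1
      (Lp.memLp (m k))).ofReal
  refine (integrable_prod_proj hsq).norm.congr (ae_of_all _ fun x => ?_)
  simp only [norm_prod, norm_pow, Complex.norm_real, norm_norm, Finset.prod_pow,
    Function.comp_apply]

lemma ae_forall_proj {ι : Type*} [Countable ι] {P : ι → Cantor → Prop} (k : ι → Fin p ⊕ Fin q)
    (h : ∀ i, ∀ᵐ a ∂lam, P i a) : ∀ᵐ x ∂muPQ p q, ∀ i, P i (proj (k i) x) :=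
  ae_all_iff.2 fun i => (measurePreserving_proj (k i)).quasiMeasurePreserving.ae (h i)

lemma prod_update_proj [DecidableEq (Fin p ⊕ Fin q)] (m : Fin p ⊕ Fin q → Lp ℂ 2 lam)
    (k : Fin p ⊕ Fin q) (u : Lp ℂ 2 lam) (x : CSpace p q) :
    ∏ l, Function.update m k u l (proj l x) =
      MultilinearMap.mkPiAlgebra ℂ (Fin p ⊕ Fin q) ℂ
        (Function.update (fun l => m l (proj l x)) k (u (proj k x))) := by
  rw [MultilinearMap.mkPiAlgebra_apply]
  exact Finset.prod_congr rfl fun l _ =>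
    Function.apply_update (fun l (w : Lp ℂ 2 lam) => w (proj l x)) m k u l

/-- The function `x ↦ ∏ k, m k (x k)` of the `p + q` coordinates of `x`, as an element of `L²`
which depends multilinearly on the factors. -/
def tens : MultilinearMap ℂ (fun _ : Fin p ⊕ Fin q => Lp ℂ 2 lam) (Lp ℂ 2 (muPQ p q)) where
  toFun m := (memLp_prod_proj m).toLp _
  map_update_add' m k u v := by
    refine Lp.ext ?_
    filter_upwards [(memLp_prod_proj (Function.update m k (u + v))).coeFn_toLp,
      (memLp_prod_proj (Function.update m k u)).coeFn_toLp,
      (memLp_prod_proj (Function.update m k v)).coeFn_toLp, Lp.coeFn_add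
        ((memLp_prod_proj (Function.update m k u)).toLp _)
        ((memLp_prod_proj (Function.update m k v)).toLp _),
      (measurePreserving_proj k).quasiMeasurePreserving.ae (Lp.coeFn_add u v)]
      with x huv hu hv hadd hk
    rw [huv, hadd, Pi.add_apply, hu, hv, prod_update_proj, prod_update_proj, prod_update_proj, hk,
      Pi.add_apply, MultilinearMap.map_update_add]
  map_update_smul' m k c u := by
    refine Lp.ext ?_
    filter_upwards [(memLp_prod_proj (Function.update m k (c • u))).coeFn_toLp,
      (memLp_prod_proj (Function.update m k u)).coeFn_toLp,
      Lp.coeFn_smul c ((memLp_prod_proj (Function.update m k u)).toLp _),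
      (measurePreserving_proj k).quasiMeasurePreserving.ae (Lp.coeFn_smul c u)]
      with x hcu hu hsmul hk
    rw [hcu, hsmul, Pi.smul_apply, hu, prod_update_proj, prod_update_proj, hk, Pi.smul_apply,
      MultilinearMap.map_update_smul]

lemma coeFn_tens (m : Fin p ⊕ Fin q → Lp ℂ 2 lam) :
    tens m =ᵐ[muPQ p q] fun x => ∏ k, m k (proj k x) :=
  (memLp_prod_proj m).coeFn_toLp

lemma inner_tens (m m' : Fin p ⊕ Fin q → Lp ℂ 2 lam) :
    ⟪tens m, tens m'⟫_ℂ = ∏ k, ⟪m k, m' k⟫_ℂ := by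
  simp only [L2.inner_def]
  rw [← integral_prod_proj]
  refine integral_congr_ae ?_
  filter_upwards [coeFn_tens m, coeFn_tens m'] with x hm hm'
  simp only [hm, hm', RCLike.inner_apply, map_prod, Finset.prod_mul_distrib]

lemma tens_total {v : Lp ℂ 2 (muPQ p q)} (h : ∀ m, ⟪tens m, v⟫_ℂ = 0) : v = 0 := by
  have hspan (n : ℕ) : IsCountablySpanning
      (Set.pi Set.univ '' Set.pi Set.univ fun _ : Fin n => {A : Set Cantor | MeasurableSet A}) :=
    IsCountablySpanning.pi fun _ => isCountablySpanning_measurableSet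
  refine Lp.ext ((ae_eq_zero_of_setIntegral_piSystem ((Lp.memLp v).integrable one_le_two)
    (generateFrom_eq_prod generateFrom_pi generateFrom_pi (hspan p) (hspan q)).symm
    (isPiSystem_pi.prod isPiSystem_pi) ?_ ?_).trans (Lp.coeFn_zero ℂ 2 _).symm)
  · have huniv (n : ℕ) : Set.univ ∈
        Set.pi Set.univ '' Set.pi Set.univ fun _ : Fin n => {A : Set Cantor | MeasurableSet A} :=
      ⟨fun _ => Set.univ, fun _ _ => Set.mem_ofPred_eq.mpr .univ, Set.pi_univ _⟩
    exact ⟨_, huniv p, _, huniv q, Set.univ_prod_univ⟩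
  rintro _ ⟨_, ⟨A, hA, rfl⟩, _, ⟨B, hB, rfl⟩, rfl⟩
  replace hA (i) : MeasurableSet (A i) := hA i trivial
  replace hB (j) : MeasurableSet (B j) := hB j trivial
  have hS : ∀ k, MeasurableSet (Sum.elim A B k) := Sum.forall.2 ⟨hA, hB⟩
  have hmem (x : CSpace p q) :
      x ∈ Set.univ.pi A ×ˢ Set.univ.pi B ↔ ∀ k, proj k x ∈ Sum.elim A B k := by
    simp [Sum.forall, proj]
  change ∫ x in Set.univ.pi A ×ˢ Set.univ.pi B, v x ∂muPQ p q = 0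
  rw [← h fun k => indicatorConstLp 2 (hS k) (measure_ne_top _ _) 1, L2.inner_def,
    ← integral_indicator ((MeasurableSet.univ_pi hA).prod (MeasurableSet.univ_pi hB))]
  refine integral_congr_ae ?_
  filter_upwards [coeFn_tens fun k => indicatorConstLp 2 (hS k) (measure_ne_top lam _) (1 : ℂ),
    ae_forall_proj id fun k => indicatorConstLp_coeFn (p := 2) (hs := hS k)
      (hμs := measure_ne_top lam _) (c := (1 : ℂ))] with x htens hind
  classical
  simp only [id] at hind
  simp only [htens, hind, RCLike.inner_apply, Set.indicator_apply, Finset.prod_ite_zero,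
    Finset.prod_const_one, Finset.mem_univ, forall_true_left, hmem]
  split_ifs <;> simp

lemma compMeasurePreserving_tens (σ : Equiv.Perm (Fin p)) (τ : Equiv.Perm (Fin q))
    (m : Fin p ⊕ Fin q → Lp ℂ 2 lam) :
    Lp.compMeasurePreserving _ (mp_perm p q σ τ) (tens (m ∘ Equiv.sumCongr σ τ)) = tens m := by
  refine Lp.ext ?_
  filter_upwards [Lp.coeFn_compMeasurePreserving (tens (m ∘ Equiv.sumCongr σ τ)) (mp_perm p q σ τ),
    (mp_perm p q σ τ).quasiMeasurePreserving.ae_eq_comp (coeFn_tens (m ∘ Equiv.sumCongr σ τ)),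
    coeFn_tens m] with x hcomp hperm hm
  rw [hcomp, hperm, hm, Function.comp_apply]
  refine (Finset.prod_congr rfl fun k _ => ?_).trans ((Equiv.sumCongr σ τ).prod_comp _)
  cases k <;> rfl

lemma coeFn_rMap (g : L0) : rMap p q g =ᵐ[muPQ p q] rFun p q g :=
  AEEqFun.coeFn_mk _ _

lemma circleMul_rMap_tens (g : L0) (m : Fin p ⊕ Fin q → Lp ℂ 2 lam) :
    circleMul (rMap p q g) (tens m) =
      tens (Sum.elim (fun i => circleMul g (m (.inl i))) fun j => circleMul g⁻¹ (m (.inr j))) := by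
  refine Lp.ext ?_
  filter_upwards [coeFn_circleMul (rMap p q g) (tens m), coeFn_tens m,
    coeFn_rMap g, coeFn_tens _,
    ae_forall_proj Sum.inl fun i => coeFn_circleMul g (m (.inl i)),
    ae_forall_proj Sum.inr fun j => coeFn_circleMul g⁻¹ (m (.inr j)),
    ae_forall_proj (Sum.inr : Fin q → Fin p ⊕ Fin q) fun _ => AEEqFun.coeFn_inv g]
    with x hmul hm hr htens hp hq hinv
  rw [hmul, hm, hr, htens, Fintype.prod_sum_type, Fintype.prod_sum_type]
  simp only [Sum.elim_inl, Sum.elim_inr, hp, hq, hinv, Finset.prod_mul_distrib]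
  rw [← mul_mul_mul_comm]
  congr 1
  simp only [rFun, proj, Circle.coe_mul, Sum.elim_inl, Sum.elim_inr, Pi.inv_apply]
  exact congrArg₂ (· * ·) (map_prod Circle.coeHom _ _) (map_prod Circle.coeHom _ _)

end Tensor

section Polarization

variable {E : Type*} [AddCommGroup E] [Module ℂ E]

lemma sum_perm_sum_perm_eq_zero_of_diag_eq_zero {ι κ : Type*} [Fintype ι] [DecidableEq ι]
    [Fintype κ] [DecidableEq κ] (M : MultilinearMap ℂ (fun _ : ι ⊕ κ => E) ℂ)
    (h : ∀ x y, M (Sum.elim (fun _ => x) fun _ => y) = 0) (x : ι → E) (y : κ → E) :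
    ∑ σ : Equiv.Perm ι, ∑ τ : Equiv.Perm κ, M (Sum.elim (x ∘ σ) (y ∘ τ)) = 0 := by
  have hswap (u : ι → E) (v : κ → E) :
      (M.domDomCongr (Equiv.sumComm ι κ)).currySum v u = M (Sum.elim u v) := by
    rw [MultilinearMap.currySum_apply', MultilinearMap.domDomCongr_apply]
    congr 1
    ext (i | i) <;> rfl
  have hsum := sum_perm_eq_zero_of_diag_eq_zero
    (∑ τ : Equiv.Perm κ, (M.domDomCongr (Equiv.sumComm ι κ)).currySum (y ∘ τ)) (fun v => ?_) x
  · simpa only [sum_apply, hswap] using hsum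
  simp only [sum_apply, hswap]
  exact sum_perm_eq_zero_of_diag_eq_zero (M.currySum fun _ => v) (h v) y

/-- With `a = (x + star y) / 2` and `b = (x - star y) / (2 * I)`, the expression
`M (a + t • b, …; star a + t • star b, …)` is polynomial in `t`, vanishes for real `t`, and has
the value `M (x, …; y, …)` at `t = i`. -/
lemma diag_eq_zero_of_star_diag_eq_zero {ι κ : Type*} [Finite ι] [Finite κ] [StarAddMonoid E]
    [StarModule ℂ E] (M : MultilinearMap ℂ (fun _ : ι ⊕ κ => E) ℂ)
    (h : ∀ x, M (Sum.elim (fun _ => star x) fun _ => x) = 0) (x y : E) :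
    M (Sum.elim (fun _ => x) fun _ => y) = 0 := by
  let a : E := (2⁻¹ : ℂ) • (x + star y)
  let b : E := (2 * Complex.I)⁻¹ • (x - star y)
  have hline (t : ℂ) : Sum.elim (fun _ : ι => a) (fun _ : κ => star a) +
      t • Sum.elim (fun _ => b) (fun _ => star b) =
        Sum.elim (fun _ => a + t • b) fun _ => star a + t • star b := by
    ext (i | i) <;> rfl
  have hx : a + Complex.I • b = x := by
    simp only [a, b]
    match_scalars <;> field_simp <;> norm_num
  have hy : star a + Complex.I • star b = y := by
    simp only [a, b, star_smul, star_add, star_sub, star_star]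
    match_scalars <;> simp <;> field_simp <;> norm_num
  rw [← hx, ← hy, ← hline]
  refine map_add_smul_eq_zero_of_infinite M _ _
    (Set.infinite_range_of_injective Complex.ofReal_injective) ?_ _
  rintro _ ⟨t, rfl⟩
  rw [hline]
  convert h (star a + (t : ℂ) • star b) using 4
  simp [star_smul]

end Polarization

section Star

variable {α : Type*} [MeasurableSpace α] {μ : Measure α} {r : ℝ≥0∞}

instance : StarAddMonoid (Lp ℂ r μ) where
  star_add f g := by
    refine Lp.ext ?_
    filter_upwards [Lp.coeFn_star (f + g), Lp.coeFn_add f g, Lp.coeFn_add (star f) (star g),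
      Lp.coeFn_star f, Lp.coeFn_star g] with x hfg hadd hstar hf hg
    rw [hfg, hstar, Pi.add_apply, hf, hg, Pi.star_apply, hadd]
    exact star_add _ _

instance : StarModule ℂ (Lp ℂ r μ) where
  star_smul c f := by
    refine Lp.ext ?_
    filter_upwards [Lp.coeFn_star (c • f), Lp.coeFn_smul c f, Lp.coeFn_smul (star c) (star f),
      Lp.coeFn_star f] with x hcf hsmul hstar hf
    rw [hcf, hstar, Pi.smul_apply, hf, Pi.star_apply, hsmul]
    exact star_smul c (f x)

lemma inner_star_star (f g : Lp ℂ 2 μ) : ⟪star f, star g⟫_ℂ = ⟪g, f⟫_ℂ := by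
  rw [L2.inner_def, L2.inner_def]
  refine integral_congr_ae ?_
  filter_upwards [Lp.coeFn_star f, Lp.coeFn_star g] with x hf hg
  rw [hf, hg, Pi.star_apply, Pi.star_apply, RCLike.inner_apply, RCLike.inner_apply]
  exact (mul_comm _ _).trans (congrArg (· * _) (star_star (f x)))

lemma star_circleMul_inv (u : α →ₘ[μ] Circle) (f : Lp ℂ 2 μ) :
    star (circleMul u⁻¹ f) = circleMul u (star f) := by
  refine Lp.ext ?_
  filter_upwards [Lp.coeFn_star (circleMul u⁻¹ f), coeFn_circleMul u⁻¹ f,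
    coeFn_circleMul u (star f), Lp.coeFn_star f, AEEqFun.coeFn_inv u]
    with x hstar hinv hmul hf hu
  rw [hstar, hmul, hf, Pi.star_apply, Pi.star_apply, hinv, hu, Pi.inv_apply, star_mul',
    Circle.coe_inv_eq_conj]
  exact congrArg (· * _) (star_star (u x : ℂ))

end Star

section SymmetricTensor

variable {p q : ℕ}

instance : CompleteSpace (symL2 p q) := by
  have hinter : (symL2 p q : Set (Lp ℂ 2 (muPQ p q))) =
      ⋂ σ, ⋂ τ, {f | Lp.compMeasurePreserving _ (mp_perm p q σ τ) f = f} := by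
    ext f
    simp only [Set.mem_iInter]
    rfl
  have hclosed : IsClosed (symL2 p q : Set (Lp ℂ 2 (muPQ p q))) := hinter ▸
    isClosed_iInter fun σ => isClosed_iInter fun τ => isClosed_eq
      (Lp.compMeasurePreservingₗᵢ ℂ _ (mp_perm p q σ τ)).continuous continuous_id
  exact hclosed.completeSpace_coe

lemma tens_diag_mem_symL2 (x y : Lp ℂ 2 lam) :
    tens (Sum.elim (fun _ => x) fun _ => y) ∈ symL2 p q := by
  intro σ τ
  convert compMeasurePreserving_tens σ τ (Sum.elim (fun _ => x) fun _ => y) using 3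
  ext1 (i | i) <;> rfl

lemma inner_tens_comp_sumCongr {v : Lp ℂ 2 (muPQ p q)} (hv : v ∈ symL2 p q)
    (m : Fin p ⊕ Fin q → Lp ℂ 2 lam) (σ : Equiv.Perm (Fin p)) (τ : Equiv.Perm (Fin q)) :
    ⟪v, tens (m ∘ Equiv.sumCongr σ τ)⟫_ℂ = ⟪v, tens m⟫_ℂ := by
  rw [← compMeasurePreserving_tens σ τ m]
  nth_rw 2 [← hv σ τ]
  exact ((Lp.compMeasurePreservingₗᵢ ℂ _ (mp_perm p q σ τ) :
    Lp ℂ 2 (muPQ p q) →ₗᵢ[ℂ] _).inner_map_map _ _).symm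

lemma tens_star_diag_total {v : Lp ℂ 2 (muPQ p q)} (hv : v ∈ symL2 p q)
    (h : ∀ x, ⟪tens (Sum.elim (fun _ => star x) fun _ => x), v⟫_ℂ = 0) : v = 0 := by
  refine tens_total fun m => inner_eq_zero_symm.1 ?_
  let M : MultilinearMap ℂ (fun _ : Fin p ⊕ Fin q => Lp ℂ 2 lam) ℂ :=
    (innerₛₗ ℂ v).compMultilinearMap tens
  have hM := sum_perm_sum_perm_eq_zero_of_diag_eq_zero M
    (diag_eq_zero_of_star_diag_eq_zero M fun x => inner_eq_zero_symm.1 (h x)) (m ∘ .inl) (m ∘ .inr)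
  have hperm (σ : Equiv.Perm (Fin p)) (τ : Equiv.Perm (Fin q)) :
      M (Sum.elim ((m ∘ .inl) ∘ σ) ((m ∘ .inr) ∘ τ)) = ⟪v, tens m⟫_ℂ := by
    rw [← inner_tens_comp_sumCongr hv m σ τ]
    refine congrArg M (funext ?_)
    rintro (i | i) <;> rfl
  simpa [hperm, Fintype.card_perm, Nat.factorial_ne_zero] using hM

end SymmetricTensor

/-! ### Power series in a complex variable and its conjugate -/

/-- The index set of the sum: the pairs of degrees other than `(0, 0)`. -/
abbrev PosDegree : Type := {i : ℕ × ℕ // 0 < i.1 + i.2}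

section PowerSeries

open Finset.HasAntidiagonal (antidiagonal mem_antidiagonal)

lemma coeff_eq_zero_of_hasSum_zero {b : ℕ → ℂ} (h : ∀ r : ℝ, HasSum (fun n => r ^ n • b n) 0)
    (n : ℕ) : b n = 0 := by
  let P : FormalMultilinearSeries ℝ ℝ ℂ := fun n =>
    ContinuousMultilinearMap.mkPiRing ℝ (Fin n) (b n)
  have hP : HasFPowerSeriesAt (fun _ => 0) P 0 := hasFPowerSeriesAt_iff.2 <|
    Eventually.of_forall fun r => by
      simpa [P, FormalMultilinearSeries.coeff] using h r
  simpa [P] using DFunLike.congr_fun (congrFun hP.eq_zero n) 1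

lemma coeff_eq_zero_of_circle {n : ℕ} {a : ℕ × ℕ → ℂ}
    (h : ∀ w : Circle, ∑ i ∈ antidiagonal n, a i * (w ^ i.1 * conj (w : ℂ) ^ i.2) = 0)
    {i : ℕ × ℕ} (hi : i ∈ antidiagonal n) : a i = 0 := by
  have : Infinite Circle :=
    Circle.argEquiv.infinite_iff.2 (Set.Ioc_infinite (by linarith [Real.pi_pos])).to_subtype
  have hinf : (Set.range fun w : Circle => (w : ℂ)).Infinite :=
    Set.infinite_range_of_injective (α := Circle) Circle.coe_injective
  let P : ℂ[X] := ∑ i ∈ antidiagonal n, C (a i) * X ^ (2 * i.1)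
  have hroot (w : Circle) : P.IsRoot w := by
    have hterm (j) (hj : j ∈ antidiagonal n) : a j * (w : ℂ) ^ (2 * j.1) =
        w ^ n * (a j * (w ^ j.1 * conj (w : ℂ) ^ j.2)) := by
      have hw : (w : ℂ) ^ j.2 * conj (w : ℂ) ^ j.2 = 1 := by
        rw [← mul_pow, Complex.mul_conj, Circle.normSq_coe, Complex.ofReal_one, one_pow]
      rw [← mem_antidiagonal.1 hj, pow_add, two_mul, pow_add]
      linear_combination -(a j * (w : ℂ) ^ j.1 * w ^ j.1) * hw
    simp only [P, IsRoot, eval_finsetSum, eval_mul, eval_C, eval_pow, eval_X]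
    rw [Finset.sum_congr rfl hterm, ← Finset.mul_sum, h, mul_zero]
  have hP : P = 0 := eq_zero_of_infinite_isRoot P
    (hinf.mono (Set.range_subset_iff.2 hroot))
  have hcoeff : P.coeff (2 * i.1) = a i := by
    simp only [P, finsetSum_coeff, coeff_C_mul_X_pow]
    rw [Finset.sum_eq_single_of_mem i hi fun j hj hji => if_neg fun hij => hji ?_, if_pos rfl]
    simp only [mem_antidiagonal] at hi hj
    exact Prod.ext (by lia) (by lia)
  rw [← hcoeff, hP, coeff_zero]

lemma coeff_eq_zero_of_hasSum_conj {a : ℕ × ℕ → ℂ}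
    (h : ∀ z : ℂ, HasSum (fun i => a i * (z ^ i.1 * conj z ^ i.2)) 0) (i : ℕ × ℕ) : a i = 0 := by
  refine coeff_eq_zero_of_circle (fun w => ?_) (mem_antidiagonal.2 rfl)
  refine coeff_eq_zero_of_hasSum_zero
    (b := fun n => ∑ i ∈ antidiagonal n, a i * (w ^ i.1 * conj (w : ℂ) ^ i.2))
    (fun r => ?_) _
  have hsigma := (Finset.HasAntidiagonal.sigmaAntidiagonalEquivProd.hasSum_iff.2 (h (r * w))).sigma
    fun n => hasSum_fintype _
  convert hsigma using 2 with n
  rw [← Finset.sum_coe_sort, Finset.smul_sum]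
  refine Finset.sum_congr rfl fun j _ => ?_
  simp [← mem_antidiagonal.1 j.2, Finset.HasAntidiagonal.sigmaAntidiagonalEquivProd, mul_pow,
    pow_add]
  ring

lemma hasSum_exp_add (a b : ℂ) :
    HasSum (fun i : ℕ × ℕ => a ^ i.1 / (i.1.factorial : ℂ) * (b ^ i.2 / (i.2.factorial : ℂ)))
      (Complex.exp (a + b)) := by
  have hexp (z : ℂ) : HasSum (fun n : ℕ => z ^ n / (n.factorial : ℂ)) (Complex.exp z) := by
    rw [Complex.exp_eq_exp_ℂ]
    exact NormedSpace.expSeries_div_hasSum_exp z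
  have hsum := summable_mul_of_summable_norm
    (NormedSpace.norm_expSeries_div_summable a) (NormedSpace.norm_expSeries_div_summable b)
  have hmul := (hexp a).mul (hexp b) hsum
  rwa [← Complex.exp_add] at hmul

lemma hasSum_pos_degree {f : ℕ × ℕ → ℂ} {s : ℂ} (h : HasSum f s) :
    HasSum (fun i : PosDegree => f i) (s - f (0, 0)) := by
  have hpos (i : ℕ × ℕ) : 0 < i.1 + i.2 ↔ i ∉ ({(0, 0)} : Finset (ℕ × ℕ)) := by
    rw [Finset.mem_singleton, Prod.ext_iff]
    lia
  refine (Equiv.subtypeEquivRight hpos).hasSum_iff.2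
    ((Finset.hasSum_compl_iff {(0, 0)} (f := f)).2 ?_)
  rwa [Finset.sum_singleton, sub_add_cancel]

end PowerSeries

/-! ### Exponential vectors of the symmetric tensors -/

section Fock

variable {p q : ℕ}

/-- The component `(p! q!)^(-1/2) h̄ ⊗ ⋯ ⊗ h̄ ⊗ h ⊗ ⋯ ⊗ h` of the exponential vector of `h`. -/
def fockComp (p q : ℕ) (h : Lp ℂ 2 lam) : symL2 p q :=
  ((√(p.factorial * q.factorial) : ℝ) : ℂ)⁻¹ •
    ⟨tens (Sum.elim (fun _ => star h) fun _ => h), tens_diag_mem_symL2 _ _⟩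

lemma coe_fockComp (h : Lp ℂ 2 lam) : (fockComp p q h : Lp ℂ 2 (muPQ p q)) =
    ((√(p.factorial * q.factorial) : ℝ) : ℂ)⁻¹ • tens (Sum.elim (fun _ => star h) fun _ => h) :=
  rfl

lemma inner_fockComp (h k : Lp ℂ 2 lam) : ⟪fockComp p q h, fockComp p q k⟫_ℂ =
    ⟪k, h⟫_ℂ ^ p / (p.factorial : ℂ) * (⟪h, k⟫_ℂ ^ q / (q.factorial : ℂ)) := by
  have hsqrt : ((√(p.factorial * q.factorial) : ℝ) : ℂ) ^ 2 = p.factorial * q.factorial := by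
    exact_mod_cast Real.sq_sqrt (by positivity)
  rw [Submodule.coe_inner, coe_fockComp, coe_fockComp, inner_smul_left, inner_smul_right,
    inner_tens, Fintype.prod_sum_type]
  simp only [Sum.elim_inl, Sum.elim_inr, inner_star_star, Finset.prod_const, Finset.card_univ,
    Fintype.card_fin, map_inv₀, Complex.conj_ofReal]
  rw [← mul_assoc, ← mul_inv, ← sq, hsqrt, mul_inv]
  ring

lemma fockComp_smul (z : ℂ) (h : Lp ℂ 2 lam) :
    fockComp p q (z • h) = (conj z ^ p * z ^ q) • fockComp p q h := by
  have htens : tens (p := p) (q := q) (Sum.elim (fun _ => star (z • h)) fun _ => z • h) =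
      (conj z ^ p * z ^ q) • tens (Sum.elim (fun _ => star h) fun _ => h) := by
    convert tens.map_smul_univ (Sum.elim (fun _ => conj z) fun _ => z)
      (Sum.elim (fun _ => star h) fun _ => h) using 2
    · ext1 (_ | _)
      · exact star_smul z h
      · rfl
    · simp
  rw [fockComp, fockComp, smul_comm]
  exact congrArg _ (Subtype.ext htens)

lemma inner_fockComp_smul (z : ℂ) (h : Lp ℂ 2 lam) (v : symL2 p q) :
    ⟪fockComp p q (z • h), v⟫_ℂ = ⟪fockComp p q h, v⟫_ℂ * (z ^ p * conj z ^ q) := by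
  rw [fockComp_smul, Submodule.coe_inner, Submodule.coe_smul, inner_smul_left,
    ← Submodule.coe_inner, map_mul, map_pow, map_pow, Complex.conj_conj, mul_comm]

lemma fockComp_total {v : symL2 p q} (h : ∀ x, ⟪fockComp p q x, v⟫_ℂ = 0) : v = 0 := by
  refine Subtype.ext (tens_star_diag_total v.2 fun x => ?_)
  have hx := h x
  rw [Submodule.coe_inner, coe_fockComp, inner_smul_left, mul_eq_zero] at hx
  refine hx.resolve_left ?_
  rw [map_inv₀, Complex.conj_ofReal, inv_eq_zero, Complex.ofReal_eq_zero, ← ne_eq]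
  positivity

lemma rho_fockComp (g : L0) (h : Lp ℂ 2 lam) :
    rho p q g (fockComp p q h) = fockComp p q (circleMul g⁻¹ h) := by
  rw [fockComp, map_smul, fockComp]
  refine congrArg _ (Subtype.ext ((circleMul_rMap_tens g _).trans ?_))
  simp only [Sum.elim_inl, Sum.elim_inr, star_circleMul_inv]

/-- The `ℓ²`-sum of the spaces of symmetric functions of positive degree. -/
abbrev Fock : Type := lp (fun i : PosDegree => symL2 i.1.1 i.1.2) 2

lemma hasSum_inner_fockComp (h k : Lp ℂ 2 lam) :
    HasSum (fun i : PosDegree =>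
      ⟪fockComp i.1.1 i.1.2 h, fockComp i.1.1 i.1.2 k⟫_ℂ)
      (Complex.exp (⟪k, h⟫_ℂ + ⟪h, k⟫_ℂ) - 1) := by
  simp only [inner_fockComp]
  simpa using hasSum_pos_degree (hasSum_exp_add ⟪k, h⟫_ℂ ⟪h, k⟫_ℂ)

lemma memℓp_fockComp (h : Lp ℂ 2 lam) :
    Memℓp (fun i : PosDegree => fockComp i.1.1 i.1.2 h) 2 := by
  refine memℓp_gen ?_
  have hsum := (hasSum_inner_fockComp h h).summable.norm
  simpa [inner_self_eq_norm_sq_to_K] using hsum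

/-- The part of positive degree of the exponential vector of `h`. -/
def fockVec (h : Lp ℂ 2 lam) : Fock :=
  ⟨_, memℓp_fockComp h⟩

lemma inner_fockVec (h k : Lp ℂ 2 lam) :
    ⟪fockVec h, fockVec k⟫_ℂ = Complex.exp (⟪k, h⟫_ℂ + ⟪h, k⟫_ℂ) - 1 :=
  (lp.hasSum_inner (fockVec h) (fockVec k)).unique (hasSum_inner_fockComp h k)

/-- `⟪fockVec (z • h), v⟫` is a power series in `z` and its conjugate, whose coefficients are the
inner products with the components of `fockVec h`. -/
lemma fockVec_total {v : Fock} (hv : ∀ h, ⟪fockVec h, v⟫_ℂ = 0) : v = 0 := by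
  ext1
  funext i
  refine fockComp_total fun h => ?_
  let a : ℕ × ℕ → ℂ := Function.extend Subtype.val
    (fun j : PosDegree => ⟪fockComp j.1.1 j.1.2 h, v j⟫_ℂ) 0
  have ha (j : PosDegree) : a j = ⟪fockComp j.1.1 j.1.2 h, v j⟫_ℂ :=
    Subtype.val_injective.extend_apply _ _ j
  rw [← ha]
  refine coeff_eq_zero_of_hasSum_conj (fun z => ?_) i.1
  have hterm (j : PosDegree) : a j * (z ^ j.1.1 * conj z ^ j.1.2) =
      ⟪fockVec (z • h) j, v j⟫_ℂ :=
    (congrArg (· * _) (ha j)).trans (inner_fockComp_smul z h (v j)).symm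
  have hsum := lp.hasSum_inner (𝕜 := ℂ) (fockVec (z • h)) v
  rw [hv, ← funext hterm] at hsum
  refine (Subtype.val_injective.hasSum_iff fun j hj => ?_).1 hsum
  simp [a, Function.extend_apply' _ _ _ hj]

lemma ellTwoSum_rho_fockVec (g : L0) (h : Lp ℂ 2 lam) :
    UnitaryRep.ellTwoSum (fun i : PosDegree => rho i.1.1 i.1.2) g (fockVec h) =
      fockVec (circleMul g⁻¹ h) := by
  ext1
  funext i
  exact rho_fockComp g h

end Fock

/-! ### Exponential vectors of the Gaussian space -/

section Gaussian

lemma weylL2_zero : weylL2 (0 : Lp ℂ 2 gamInf) = Lp.const 2 gamInf (1 : ℂ) := by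
  refine Lp.ext ((coeFn_weylL2 0).trans ?_)
  filter_upwards [Lp.coeFn_zero ℂ 2 gamInf, Lp.coeFn_const (p := 2) (μ := gamInf) (1 : ℂ)]
    with f h0 h1
  rw [h0, h1, Pi.zero_apply, weyl_zero, Function.const_apply]

lemma mem_constants_orthogonal {v : Lp ℂ 2 gamInf} :
    v ∈ (constants gamInf)ᗮ ↔ ⟪weylL2 0, v⟫_ℂ = 0 := by
  have hspan : constants gamInf = ℂ ∙ weylL2 0 := by
    rw [weylL2_zero, ← LinearMap.range_toSpanSingleton]
    refine congrArg LinearMap.range (LinearMap.ext_ring ?_)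
    rw [LinearMap.toSpanSingleton_apply, one_smul, Lp.constₗ_apply]
  rw [hspan, Submodule.mem_orthogonal_singleton_iff_inner_right]

lemma inner_weylL2_isonormal (h k : Lp ℂ 2 lam) :
    ⟪weylL2 (isonormal h), weylL2 (isonormal k)⟫_ℂ = Real.exp (-‖k - h‖ ^ 2) := by
  rw [inner_weylL2, ← map_sub, integral_weyl_isonormal]

/-- The exponential vector `exp (‖h‖²) weyl (isonormal h)`. -/
def gaussExp (h : Lp ℂ 2 lam) : Lp ℂ 2 gamInf :=
  (Real.exp (‖h‖ ^ 2) : ℂ) • weylL2 (isonormal h)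

lemma inner_gaussExp (h k : Lp ℂ 2 lam) :
    ⟪gaussExp h, gaussExp k⟫_ℂ = Complex.exp (⟪k, h⟫_ℂ + ⟪h, k⟫_ℂ) := by
  have hexponent : ((‖h‖ ^ 2 + ‖k‖ ^ 2 + -‖k - h‖ ^ 2 : ℝ) : ℂ) = ⟪k, h⟫_ℂ + ⟪h, k⟫_ℂ := by
    have hself (x : Lp ℂ 2 lam) : (‖x‖ : ℂ) ^ 2 = ⟪x, x⟫_ℂ := (inner_self_eq_norm_sq_to_K x).symm
    push_cast
    rw [hself, hself, hself, inner_sub_left, inner_sub_right, inner_sub_right]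
    ring
  rw [gaussExp, gaussExp, inner_smul_left, inner_smul_right, inner_weylL2_isonormal,
    Complex.conj_ofReal, ← hexponent]
  push_cast
  rw [Complex.exp_add, Complex.exp_add, mul_assoc]

lemma gaussExp_zero : gaussExp 0 = Lp.const 2 gamInf (1 : ℂ) := by
  simp [gaussExp, weylL2_zero]

lemma gaussExp_sub_mem (h : Lp ℂ 2 lam) : gaussExp h - gaussExp 0 ∈ (constants gamInf)ᗮ := by
  rw [mem_constants_orthogonal, weylL2_zero, ← gaussExp_zero, inner_sub_right, inner_gaussExp,
    inner_gaussExp]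
  simp

/-- The component of the exponential vector of `h` orthogonal to the constants. -/
def gaussVec (h : Lp ℂ 2 lam) : ↥(constants gamInf)ᗮ :=
  ⟨gaussExp h - gaussExp 0, gaussExp_sub_mem h⟩

lemma inner_gaussVec (h k : Lp ℂ 2 lam) :
    ⟪gaussVec h, gaussVec k⟫_ℂ = Complex.exp (⟪k, h⟫_ℂ + ⟪h, k⟫_ℂ) - 1 := by
  rw [Submodule.coe_inner, gaussVec, gaussVec, inner_sub_left, inner_sub_right, inner_sub_right]
  simp only [inner_gaussExp, inner_zero_left, inner_zero_right, add_zero, Complex.exp_zero]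
  ring

lemma gaussVec_total {v : ↥(constants gamInf)ᗮ} (hv : ∀ h, ⟪gaussVec h, v⟫_ℂ = 0) : v = 0 := by
  refine Subtype.ext (weylL2_isonormal_total fun h => ?_)
  have hconst : ⟪gaussExp 0, (v : Lp ℂ 2 gamInf)⟫_ℂ = 0 := by
    rw [gaussExp_zero, ← weylL2_zero]
    exact mem_constants_orthogonal.1 v.2
  have hh := hv h
  rw [Submodule.coe_inner, gaussVec, inner_sub_left, hconst, sub_zero, gaussExp, inner_smul_left,
    mul_eq_zero] at hh
  exact hh.resolve_left (by simp)

lemma koopman_gaussExp (g : L0) (h : Lp ℂ 2 lam) :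
    koopman gamInf (gaussAction g) (gaussExp h) = gaussExp (circleMul g⁻¹ h) := by
  rw [gaussExp, map_smul, gaussExp, LinearIsometry.norm_map]
  exact congrArg _ (compMeasurePreserving_weylL2_isonormal (circleMul g⁻¹) h)

lemma koopmanZero_gaussVec (g : L0) (h : Lp ℂ 2 lam) :
    koopmanZero gaussAction g (gaussVec h) = gaussVec (circleMul g⁻¹ h) := by
  refine Subtype.ext ((map_sub (koopman gamInf (gaussAction g)) _ _).trans ?_)
  rw [koopman_gaussExp, koopman_gaussExp, map_zero]
  rfl

end Gaussian

theorem koopmanZero_gaussAction_isomorphic :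
    (koopmanZero gaussAction).Isomorphic
      (UnitaryRep.ellTwoSum fun i : PosDegree => rho i.1.1 i.1.2) :=
  UnitaryRep.isomorphic_of_total (fun _ => gaussVec_total) (fun _ => fockVec_total)
    (fun h k => (inner_gaussVec h k).trans (inner_fockVec h k).symm)
    koopmanZero_gaussVec ellTwoSum_rho_fockVec

end KoopmanL0

end

end

theorem theorem2p3 :
    (∃! Θ : KoopmanL0.L0 →* KoopmanL0.Aut KoopmanL0.gamInf, KoopmanL0.IsGaussianAction Θ) ∧
    ∀ Θ : KoopmanL0.L0 →* KoopmanL0.Aut KoopmanL0.gamInf, KoopmanL0.IsGaussianAction Θ →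
      KoopmanL0.UnitaryRep.Isomorphic
        (KoopmanL0.koopmanZero Θ)
        (KoopmanL0.UnitaryRep.ellTwoSum
          fun i : {i : ℕ × ℕ // 0 < i.1 + i.2} => KoopmanL0.rho i.1.1 i.1.2) := by
  refine ⟨⟨KoopmanL0.gaussAction, KoopmanL0.isGaussianAction_gaussAction,
    fun Θ h => h.eq KoopmanL0.isGaussianAction_gaussAction⟩, fun Θ h => ?_⟩
  rw [h.eq KoopmanL0.isGaussianAction_gaussAction]
  exact KoopmanL0.koopmanZero_gaussAction_isomorphic
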